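/- Let $L,G_N,\varepsilon>0$. Represent a constant time slice of global AdS$_3$ of radius $L$ by the hyperbolic plane with metric $L^2(d\rho^2+\sinh^2\!\rho\,d\chi^2)$, and denote by $(u,v)$, $u<v<u+2\pi$, the oriented geodesic from the boundary point at angle $u$ to the one at angle $v$; put $\theta=\frac{u+v}2$, $\alpha=\frac{v-u}2$. Oriented geodesics form kinematic space $\mathcal K$ ($\theta\in[0,2\pi)$, $\alpha\in(0,\pi)$). Let $S(u,v)=\frac{L}{2G_N}\log\!\big(\frac2\varepsilon\sin\frac{v-u}2\big)$ be the (Ryu–Takayanagi) entanglement entropy of the boundary interval $[u,v]$ with cutoff $\varepsilon$, and let $\omega=\partial_u\partial_vS\,du\wedge dv$ be the Crofton form. Then $\omega=\frac{L}{4G_N}\,\frac{1}{2\sin^2((v-u)/2)}\,du\wedge dv$. For disjoint boundary intervals $A_1=[a_1,b_1]$, $A_2=[a_2,b_2]$ with $a_1<b_1<a_2<b_2<a_1+2\pi$, the causal shadow $Q$ is the region bounded by the four geodesics subtending $A_1$, $A_2$ and the two complementary intervals $[b_1,a_2]$, $[b_2,a_1+2\pi]$; $\mathcal K_Q\subset\mathcal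 K$ is the set of geodesics meeting $Q$, and $\lambda_Q(u,v)$ is the length of the intersection of the geodesic $(u,v)$ with $Q$. (1) Let $A_1=[-\frac\pi4,\frac\pi4]$ and $A_2=[\frac{3\pi}4,\frac{5\pi}4]$ (the phase transition for two equal, opposite intervals), $I=[-\frac\pi4,\frac\pi4]\times[\frac\pi4,\frac{3\pi}4]$ and $II=[-\frac\pi4,\frac\pi4]\times[\frac{3\pi}4,\frac{5\pi}4]$ in the coordinates $(u,v)$. Let $\chi_{\rm in}\in(-\frac\pi2,\frac\pi2)$, $\chi^I_{\rm out}\in(0,\pi)$, $\chi^{II}_{\rm out}\in(\frac\pi2,\frac{3\pi}2)$ be given by $$\tan\chi_{\rm in}=\frac{\sqrt2\cos\alpha-\cos\theta}{\sin\theta},\qquad \cot\chi^{I}_{\rm out}=\frac{\sqrt2\cos\alpha-\sin\theta}{\cos\theta},\qquad \tan\chi^{II}_{\rm out}=-\frac{\sqrt2\cos\alpha+\cos\theta}{\sin\theta},$$ and put $$\frac{\lambda_I}{L}=\operatorname{arctanh}\frac{\sin(\theta-\chi_{\rm in})}{\sqrt{2\cos^2\chi_{\rm in}-\cos^2(\theta-\chi_{\rm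 in})}}-\operatorname{arctanh}\frac{\sin(\theta-\chi^I_{\rm out})}{\sqrt{2\sin^2\chi^I_{\rm out}-\cos^2(\theta-\chi^I_{\rm out})}},$$ $$\frac{\lambda_{II}}{L}=\operatorname{arctanh}\frac{\sin(\theta-\chi_{\rm in})}{\sqrt{2\cos^2\chi_{\rm in}-\cos^2(\theta-\chi_{\rm in})}}-\operatorname{arctanh}\frac{\sin(\theta-\chi^{II}_{\rm out})}{\sqrt{2\cos^2\chi^{II}_{\rm out}-\cos^2(\theta-\chi^{II}_{\rm out})}}.$$ In the interiors of $I$ and $II$ these functions equal the chord $\lambda_Q$ of the causal shadow $Q$ of $A_1\cup A_2$; $\lambda_I\omega$ and $\lambda_{II}\omega$ are integrable over $I$ and $II$ respectively, and $$2\pi L^2=\frac{8G_N}{\pi}\Big(2\int_I\lambda_I\,\omega+\int_{II}\lambda_{II}\,\omega\Big).$$ (2) For every placement of $A_1$, $A_2$ as above, the volume of the causal shadow and its kinematic space integral both have this same value: $V(Q)=\frac{2G_N}{\pi}\int_{\mathcal K_Q}\lambda_Q\,\omega=2\pi L^2$. -/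

import Mathlib

open Real MeasureTheory Set
open scoped ENNReal

noncomputable section

/-! Conventions. A constant time slice of global AdS₃ of radius `L` is the hyperbolic plane with
metric `L² (dρ² + sinh² ρ dχ²)`. The point with cylindrical coordinates `(ρ, χ)` is represented by
the complex number `tanh ρ · exp (i χ)` of the open unit disc (projective model), in which geodesics
are straight chords. A pair `(u, v)` with `u < v < u + 2π` is the geodesic from the boundary point
`exp (i u)` to the boundary point `exp (i v)`; it subtends the boundary interval with centre
`θ = (u + v) / 2` and half-width `α = (v - u) / 2`. -/

/-- The point with cylindrical coordinates `(ρ, χ)`. -/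
def bulkPoint (ρ χ : ℝ) : ℂ :=
  (Real.tanh ρ : ℂ) * Complex.exp ((χ : ℂ) * Complex.I)

/-- The volume of a subset of the slice, for the volume form `L² sinh ρ dρ dχ`. -/
def sliceVolume (L : ℝ) (Q : Set ℂ) : ℝ≥0∞ :=
  ∫⁻ p in {p : ℝ × ℝ | 0 < p.1 ∧ 0 ≤ p.2 ∧ p.2 < 2 * π ∧ bulkPoint p.1 p.2 ∈ Q},
    ENNReal.ofReal (L ^ 2 * Real.sinh p.1)

/-- The oriented geodesic `(u, v)`, parametrized by arc length `s` in the metric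
`dρ² + sinh² ρ dχ²`: it tends to `exp (i u)` as `s → -∞` and to `exp (i v)` as `s → ∞`. -/
def geodesicPoint (u v s : ℝ) : ℂ :=
  Complex.exp (((u + v) / 2 : ℝ) * Complex.I) *
    ((Real.cos ((v - u) / 2) : ℂ) + (Real.sin ((v - u) / 2) * Real.tanh s : ℝ) * Complex.I)

/-- The chord `λ_Q(u, v)`: the length of the intersection of the geodesic `(u, v)` with `Q`. -/
def chordLength (L : ℝ) (Q : Set ℂ) (u v : ℝ) : ℝ≥0∞ :=
  ENNReal.ofReal L * volume {s : ℝ | geodesicPoint u v s ∈ Q}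

/-- The open region of the slice between the boundary interval `[u, v]` and its geodesic. In
cylindrical coordinates it is `tanh ρ cos (χ - θ) > cos α`. -/
def intervalRegion (u v : ℝ) : Set ℂ :=
  {z | ‖z‖ < 1 ∧
    Real.cos ((v - u) / 2) < (z * Complex.exp (-((u + v) / 2 : ℝ) * Complex.I)).re}

/-- The causal shadow of the two boundary intervals `A₁ = [a₁, b₁]` and `A₂ = [a₂, b₂]`: what
remains of the slice after removing the regions cut off by the geodesics of `A₁`, `A₂` and of the
two complementary intervals `[b₁, a₂]` and `[b₂, a₁ + 2π]`. -/
def causalShadow (a₁ b₁ a₂ b₂ : ℝ) : Set ℂ :=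
  {z | ‖z‖ < 1 ∧ z ∉ intervalRegion a₁ b₁ ∧ z ∉ intervalRegion b₁ a₂ ∧
    z ∉ intervalRegion a₂ b₂ ∧ z ∉ intervalRegion b₂ (a₁ + 2 * π)}

/-- The causal shadow of two opposite quarter circles. -/
def symmetricShadow : Set ℂ :=
  causalShadow (-(π / 4)) (π / 4) (3 * π / 4) (5 * π / 4)

/-- The oriented geodesics `(u, v)`, `θ ∈ [0, 2π)`, `α ∈ (0, π)`, that meet `Q`. -/
def kinematicRegion (Q : Set ℂ) : Set (ℝ × ℝ) :=
  {p | 0 ≤ (p.1 + p.2) / 2 ∧ (p.1 + p.2) / 2 < 2 * π ∧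
    0 < (p.2 - p.1) / 2 ∧ (p.2 - p.1) / 2 < π ∧ ∃ s : ℝ, geodesicPoint p.1 p.2 s ∈ Q}

/-- The entanglement entropy of the interval `[u, v]`: the regularized geodesic length
`2 L log ((2 / ε) sin ((v - u) / 2))` with cutoff `ε`, divided by `4 G`. -/
def entropy (L G ε u v : ℝ) : ℝ :=
  2 * L * Real.log (2 / ε * Real.sin ((v - u) / 2)) / (4 * G)

/-- The Crofton density: `ω = ∂_u ∂_v S du ∧ dv`. -/
def crofton (L G ε u v : ℝ) : ℝ :=
  deriv (fun u' => deriv (fun v' => entropy L G ε u' v') v) u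

/-- Geodesics from `A₁ = [-π/4, π/4]` to the adjacent complementary interval `[π/4, 3π/4]`. -/
def squareI : Set (ℝ × ℝ) :=
  Icc (-(π / 4)) (π / 4) ×ˢ Icc (π / 4) (3 * π / 4)

/-- Geodesics from `A₁ = [-π/4, π/4]` to `A₂ = [3π/4, 5π/4]`. -/
def squareII : Set (ℝ × ℝ) :=
  Icc (-(π / 4)) (π / 4) ×ˢ Icc (3 * π / 4) (5 * π / 4)

/-- Angle of the entry point, on the geodesic `(θ, α) = (0, π/4)`; values in `(-π/2, π/2)`. -/
def chiIn (u v : ℝ) : ℝ :=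
  Real.arctan ((√2 * Real.cos ((v - u) / 2) - Real.cos ((v + u) / 2)) / Real.sin ((v + u) / 2))

/-- Angle of the exit point for square `I`, on the geodesic `(θ, α) = (π/2, π/4)`; the branch of
the inverse cotangent is the one with values in `(0, π)`. -/
def chiOutI (u v : ℝ) : ℝ :=
  π / 2 -
    Real.arctan ((√2 * Real.cos ((v - u) / 2) - Real.sin ((v + u) / 2)) / Real.cos ((v + u) / 2))

/-- Angle of the exit point for square `II`, on the geodesic `(θ, α) = (π, π/4)`; the branch of
the inverse tangent is the one with values in `(π/2, 3π/2)`. -/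
def chiOutII (u v : ℝ) : ℝ :=
  π + Real.arctan
    (-((√2 * Real.cos ((v - u) / 2) + Real.cos ((v + u) / 2)) / Real.sin ((v + u) / 2)))

/-- The chord function `λ_I`. -/
def lambdaI (L u v : ℝ) : ℝ :=
  L * (Real.artanh (Real.sin ((v + u) / 2 - chiIn u v) /
        √(2 * Real.cos (chiIn u v) ^ 2 - Real.cos ((v + u) / 2 - chiIn u v) ^ 2)) -
      Real.artanh (Real.sin ((v + u) / 2 - chiOutI u v) /
        √(2 * Real.sin (chiOutI u v) ^ 2 - Real.cos ((v + u) / 2 - chiOutI u v) ^ 2)))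

/-- The chord function `λ_II`. -/
def lambdaII (L u v : ℝ) : ℝ :=
  L * (Real.artanh (Real.sin ((v + u) / 2 - chiIn u v) /
        √(2 * Real.cos (chiIn u v) ^ 2 - Real.cos ((v + u) / 2 - chiIn u v) ^ 2)) -
      Real.artanh (Real.sin ((v + u) / 2 - chiOutII u v) /
        √(2 * Real.cos (chiOutII u v) ^ 2 - Real.cos ((v + u) / 2 - chiOutII u v) ^ 2)))

end

/-! Crofton formula, for any measurable `Q`. Integrate over the geodesics `(u, u + d)` and over the
arc length `s` along them. For fixed `d` and `s`, varying `u` rotates the point about the centre, so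
only the angular measure `circleSection` at its radius survives. In the variables `t = cot (d / 2)`,
the sinh of the signed distance from the centre to the geodesic, and `y = √(1 + t²) sinh s`, the
Crofton density becomes a constant times `dt`, and the point satisfies `sinh² ρ = t² + y²`. Polar
coordinates in the `(t, y)` plane then give the volume form times `π / (2G)`: this is
`setLIntegral_kinematicRegion`.

Volume. The causal shadow is an ideal quadrilateral, so Gauss–Bonnet predicts area `2π`. It is
computed here by radial integration from the centre: along a ray `sinh ρ` integrates to a difference
of values of `cosh ρ`, and `geodesicCosh u v` integrates to `π` over `(u, v)`. If no boundary
interval is longer than `π`, the four sectors contribute `π - (v - u)` each, in all `4π - 2π`. If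
one interval is longer, the region lies between its geodesic and the three others, and the result is
`3π - π`. See `sliceVolume_causalShadow`.

Symmetric case. In the projective disc the shadow is a square and a geodesic is a segment with
affine parameter `tanh s`, so each chord is a difference of two `artanh`, which simplifies to
`lambdaI` or `lambdaII`. The symmetries of the square reduce the kinematic integral to `4 (2 I +
II)`. Integrability follows from the finiteness of the volume, with no estimate on the chord
functions. -/

/-! ### Preliminaries: periodic integrands and measurability of `tanh`. -/

theorem setLIntegral_Ioc_eq_of_periodic {T : ℝ} (hT : 0 < T) {f : ℝ → ℝ≥0∞}
    (hf : Function.Periodic f T) (a b : ℝ) :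
    ∫⁻ x in Ioc a (a + T), f x = ∫⁻ x in Ioc b (b + T), f x := by
  refine (isAddFundamentalDomain_Ioc hT a).setLIntegral_eq (isAddFundamentalDomain_Ioc hT b) f ?_
  rintro ⟨g, hg⟩ x
  obtain ⟨n, rfl⟩ := AddSubgroup.mem_zmultiples_iff.mp hg
  simpa [add_comm] using! hf.zsmul n x

theorem Real.continuous_tanh : Continuous Real.tanh := by
  have : Real.tanh = fun x => Real.sinh x / Real.cosh x :=
    funext fun x => Real.tanh_eq_sinh_div_cosh x
  rw [this]
  exact Real.continuous_sinh.div Real.continuous_cosh fun x => (Real.cosh_pos x).ne'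

theorem Real.measurable_tanh : Measurable Real.tanh := Real.continuous_tanh.measurable

/-! ### The Crofton density -/

theorem hasDerivAt_entropy_right (L G ε : ℝ) (hε : 0 < ε) {u v : ℝ} (h : Real.sin ((v - u) / 2) ≠ 0) :
    HasDerivAt (fun v' => entropy L G ε u v')
      (L / (4 * G) * (Real.cos ((v - u) / 2) / Real.sin ((v - u) / 2))) v := by
  unfold entropy
  have h1 : HasDerivAt (fun v' : ℝ => (v' - u) / 2) (1 / 2) v :=
    ((hasDerivAt_id v).sub_const u).div_const 2
  have h2 := (h1.sin.const_mul (2 / ε)).log (by positivity)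
  have h3 := (h2.const_mul (2 * L)).div_const (4 * G)
  convert! h3 using 1
  field_simp

theorem crofton_eq (L G ε : ℝ) (hε : 0 < ε) {u v : ℝ} (h : Real.sin ((v - u) / 2) ≠ 0) :
    crofton L G ε u v = L / (4 * G) * (1 / (2 * Real.sin ((v - u) / 2) ^ 2)) := by
  unfold crofton
  have hc : ContinuousAt (fun u' : ℝ => Real.sin ((v - u') / 2)) u := by fun_prop
  -- The outer derivative needs the inner one on a whole neighbourhood of `u`; nonvanishing of the
  -- sine is an open condition.
  have hev : (fun u' => deriv (fun v' => entropy L G ε u' v') v) =ᶠ[nhds u]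
      fun u' => L / (4 * G) * (Real.cos ((v - u') / 2) / Real.sin ((v - u') / 2)) := by
    filter_upwards [hc.eventually_ne h] with u' hu'
    exact (hasDerivAt_entropy_right L G ε hε hu').deriv
  rw [hev.deriv_eq]
  have h1 : HasDerivAt (fun u' : ℝ => (v - u') / 2) (-1 / 2) u :=
    ((hasDerivAt_id u).const_sub v).div_const 2
  have h2 := (h1.cos.fun_div h1.sin h).const_mul (L / (4 * G))
  rw [h2.deriv]
  have := Real.sin_sq_add_cos_sq ((v - u) / 2)
  congr 1
  field_simp
  linarith

theorem sin_half_sub_pos {u v : ℝ} (h : u < v) (h' : v < u + 2 * π) :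
    0 < Real.sin ((v - u) / 2) :=
  Real.sin_pos_of_pos_of_lt_pi (by linarith) (by linarith)

theorem crofton_nonneg {L G ε : ℝ} (hL : 0 < L) (hG : 0 < G) (hε : 0 < ε) {u v : ℝ} (h : u < v)
    (h' : v < u + 2 * π) : 0 ≤ crofton L G ε u v := by
  rw [crofton_eq L G ε hε (sin_half_sub_pos h h').ne']
  positivity

/-! ### The Crofton formula for a measurable region -/

/-- The angular measure of the part of the circle of radius `r` that lies in `Q`. -/
noncomputable def circleSection (Q : Set ℂ) (r : ℝ) : ℝ≥0∞ :=
  ∫⁻ χ in Ioc 0 (2 * π), Q.indicator 1 ((r : ℂ) * Complex.exp ((χ : ℂ) * Complex.I))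

theorem exp_periodic : Function.Periodic (fun x : ℝ => Complex.exp ((x : ℂ) * Complex.I)) (2 * π) := by
  intro x
  simp only [Complex.ofReal_add, Complex.ofReal_mul, Complex.ofReal_ofNat, add_mul]
  exact Complex.exp_periodic _

/-- A full turn forgets the argument of `z`: it only shifts the window of a periodic integrand. -/
theorem setLIntegral_rotation (Q : Set ℂ) (c : ℝ) (z : ℂ) :
    ∫⁻ u in Ioc c (c + 2 * π), Q.indicator 1 (Complex.exp ((u : ℂ) * Complex.I) * z) =
      circleSection Q ‖z‖ := by
  have hper : Function.Periodic (fun χ : ℝ => (Q.indicator 1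
      ((‖z‖ : ℂ) * Complex.exp ((χ : ℂ) * Complex.I)) : ℝ≥0∞)) (2 * π) :=
    fun x => by simp only [exp_periodic x]
  have h0 : ∀ u : ℝ, Complex.exp ((u : ℂ) * Complex.I) * z =
      (‖z‖ : ℂ) * Complex.exp (((u + z.arg : ℝ) : ℂ) * Complex.I) := by
    intro u
    conv_lhs => rw [← Complex.norm_mul_exp_arg_mul_I z]
    rw [Complex.ofReal_add, add_mul, Complex.exp_add]
    ring
  simp_rw [h0]
  have h1 := (measurePreserving_add_right volume z.arg).setLIntegral_comp_preimage_emb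
    (measurableEmbedding_addRight z.arg)
    (fun χ : ℝ => (Q.indicator 1 ((‖z‖ : ℂ) * Complex.exp ((χ : ℂ) * Complex.I)) : ℝ≥0∞))
    (Ioc (c + z.arg) (c + z.arg + 2 * π))
  have h2 : (fun x => x + z.arg) ⁻¹' Ioc (c + z.arg) (c + z.arg + 2 * π) = Ioc c (c + 2 * π) := by
    ext x; simp only [mem_preimage, mem_Ioc]; constructor <;> rintro ⟨_, _⟩ <;> constructor <;> linarith
  rw [h2] at h1
  rw [h1, setLIntegral_Ioc_eq_of_periodic Real.two_pi_pos hper _ 0, zero_add]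
  rfl

theorem measurable_circleSection {Q : Set ℂ} (hQ : MeasurableSet Q) :
    Measurable (circleSection Q) := by
  unfold circleSection
  apply Measurable.lintegral_prod_right
  exact (measurable_one.indicator hQ).comp (by fun_prop)

theorem sliceVolume_eq_lintegral {Q : Set ℂ} (hQ : MeasurableSet Q) (L : ℝ) :
    sliceVolume L Q = ENNReal.ofReal (L ^ 2) *
      ∫⁻ ρ in Ioi 0, ENNReal.ofReal (Real.sinh ρ) * circleSection Q (Real.tanh ρ) := by
  have hb : Measurable fun p : ℝ × ℝ => bulkPoint p.1 p.2 := by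
    unfold bulkPoint
    have := Real.measurable_tanh
    fun_prop
  have hset : {p : ℝ × ℝ | 0 < p.1 ∧ 0 ≤ p.2 ∧ p.2 < 2 * π ∧ bulkPoint p.1 p.2 ∈ Q} =
      {p : ℝ × ℝ | bulkPoint p.1 p.2 ∈ Q} ∩ (Ioi 0 ×ˢ Ico 0 (2 * π)) := by
    ext p; simp only [mem_ofPred_eq, mem_inter_iff, mem_prod, mem_Ioi, mem_Ico]; tauto
  have hm : MeasurableSet {p : ℝ × ℝ | bulkPoint p.1 p.2 ∈ Q} := hb hQ
  unfold sliceVolume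
  rw [hset, ← setLIntegral_indicator hm, Measure.volume_eq_prod,
    setLIntegral_prod _ (Measurable.aemeasurable (Measurable.indicator (by fun_prop) hm)),
    ← lintegral_const_mul' _ _ ENNReal.ofReal_ne_top]
  refine setLIntegral_congr_fun measurableSet_Ioi fun ρ hρ => ?_
  rw [circleSection, ← setLIntegral_congr (Ico_ae_eq_Ioc (a := (0 : ℝ)) (b := 2 * π)), ← mul_assoc,
    ← ENNReal.ofReal_mul (sq_nonneg L), ← lintegral_const_mul' _ _ ENNReal.ofReal_ne_top]
  refine lintegral_congr fun χ => ?_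
  by_cases h : bulkPoint ρ χ ∈ Q
  · have h' := h
    unfold bulkPoint at h'
    rw [indicator_of_mem (by exact h), indicator_of_mem h', Pi.one_apply, mul_one]
  · have h' := h
    unfold bulkPoint at h'
    rw [indicator_of_notMem (by exact h), indicator_of_notMem h', mul_zero]

/-- The kinematic space of all oriented geodesics. -/
def geodesicStrip : Set (ℝ × ℝ) :=
  {p | 0 ≤ (p.1 + p.2) / 2 ∧ (p.1 + p.2) / 2 < 2 * π ∧ 0 < (p.2 - p.1) / 2 ∧ (p.2 - p.1) / 2 < π}

theorem measurableSet_geodesicStrip : MeasurableSet geodesicStrip := by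
  have h1 : Measurable fun p : ℝ × ℝ => (p.1 + p.2) / 2 := by fun_prop
  have h2 : Measurable fun p : ℝ × ℝ => (p.2 - p.1) / 2 := by fun_prop
  exact (measurableSet_le measurable_const h1).inter ((measurableSet_lt h1 measurable_const).inter
    ((measurableSet_lt measurable_const h2).inter (measurableSet_lt h2 measurable_const)))

/-- The shear `d = v - u` preserves area. At fixed `d` the condition on `θ` becomes a window of
length `2π` for `u`, starting at `-d/2`, and periodicity moves that window to any `c`. -/
theorem setLIntegral_geodesicStrip {f : ℝ → ℝ → ℝ≥0∞} (hf : Measurable (Function.uncurry f))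
    (hper : ∀ u v, f (u + 2 * π) (v + 2 * π) = f u v) (c : ℝ) :
    ∫⁻ p in geodesicStrip, f p.1 p.2 =
      ∫⁻ d in Ioo 0 (2 * π), ∫⁻ u in Ioc c (c + 2 * π), f u (u + d) := by
  have hF : Measurable (geodesicStrip.indicator fun p : ℝ × ℝ => f p.1 p.2) :=
    Measurable.indicator hf measurableSet_geodesicStrip
  rw [← lintegral_indicator measurableSet_geodesicStrip, Measure.volume_eq_prod,
    lintegral_prod _ hF.aemeasurable]
  have h1 : ∀ u : ℝ, ∫⁻ v, geodesicStrip.indicator (fun p : ℝ × ℝ => f p.1 p.2) (u, v) =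
      ∫⁻ d, geodesicStrip.indicator (fun p : ℝ × ℝ => f p.1 p.2) (u, u + d) := fun u =>
    (lintegral_add_left_eq_self
      (fun v => geodesicStrip.indicator (fun p : ℝ × ℝ => f p.1 p.2) (u, v)) u).symm
  simp_rw [h1]
  have h2 : Measurable fun p : ℝ × ℝ =>
      geodesicStrip.indicator (fun p : ℝ × ℝ => f p.1 p.2) (p.1, p.1 + p.2) :=
    hF.comp (by fun_prop)
  rw [lintegral_lintegral_swap h2.aemeasurable, ← lintegral_indicator measurableSet_Ioo]
  refine lintegral_congr fun d => ?_
  by_cases hd : d ∈ Ioo 0 (2 * π)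
  · rw [indicator_of_mem hd]
    have hp : Function.Periodic (fun u => f u (u + d)) (2 * π) := fun u => by
      simp only [add_right_comm u (2 * π) d, hper]
    rw [setLIntegral_Ioc_eq_of_periodic Real.two_pi_pos hp c (-(d / 2)),
      ← setLIntegral_congr Ico_ae_eq_Ioc, ← lintegral_indicator measurableSet_Ico]
    refine lintegral_congr fun u => ?_
    have : (u, u + d) ∈ geodesicStrip ↔ u ∈ Ico (-(d / 2)) (-(d / 2) + 2 * π) := by
      simp only [geodesicStrip, mem_ofPred_eq, mem_Ico]
      obtain ⟨h1, h2⟩ := hd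
      constructor
      · rintro ⟨_, _, _, _⟩; constructor <;> linarith
      · rintro ⟨_, _⟩; refine ⟨?_, ?_, ?_, ?_⟩ <;> linarith
    by_cases hu : u ∈ Ico (-(d / 2)) (-(d / 2) + 2 * π)
    · rw [indicator_of_mem hu, indicator_of_mem (this.2 hu)]
    · rw [indicator_of_notMem hu, indicator_of_notMem (mt this.1 hu)]
  · rw [indicator_of_notMem hd]
    have : ∀ u : ℝ, (u, u + d) ∉ geodesicStrip := by
      rintro u ⟨-, -, h3, h4⟩
      exact hd ⟨by linarith, by linarith⟩
    simp [indicator_of_notMem, this]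

theorem geodesicPoint_add_two_pi (u v s : ℝ) :
    geodesicPoint (u + 2 * π) (v + 2 * π) s = geodesicPoint u v s := by
  unfold geodesicPoint
  have h1 : (u + 2 * π + (v + 2 * π)) / 2 = (u + v) / 2 + 2 * π := by ring
  have h2 : v + 2 * π - (u + 2 * π) = v - u := by ring
  have h3 := exp_periodic ((u + v) / 2)
  simp only at h3
  rw [h1, h2, h3]

theorem chordLength_add_two_pi (L : ℝ) (Q : Set ℂ) (u v : ℝ) :
    chordLength L Q (u + 2 * π) (v + 2 * π) = chordLength L Q u v := by
  simp only [chordLength, geodesicPoint_add_two_pi]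

theorem measurable_geodesicPoint :
    Measurable fun p : (ℝ × ℝ) × ℝ => geodesicPoint p.1.1 p.1.2 p.2 := by
  unfold geodesicPoint
  have := Real.measurable_tanh
  fun_prop

theorem measurable_chordLength (L : ℝ) {Q : Set ℂ} (hQ : MeasurableSet Q) :
    Measurable fun p : ℝ × ℝ => chordLength L Q p.1 p.2 :=
  (measurable_measure_prodMk_left (measurable_geodesicPoint hQ)).const_mul _

theorem chordLength_eq_lintegral (L : ℝ) {Q : Set ℂ} (hQ : MeasurableSet Q) (u v : ℝ) :
    chordLength L Q u v =
      ENNReal.ofReal L * ∫⁻ s, Q.indicator 1 (geodesicPoint u v s) := by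
  have hm : Measurable fun s => geodesicPoint u v s := by
    unfold geodesicPoint
    have := Real.measurable_tanh
    fun_prop
  have : ∀ s, (Q.indicator 1 (geodesicPoint u v s) : ℝ≥0∞) =
      {s : ℝ | geodesicPoint u v s ∈ Q}.indicator 1 s := fun s => rfl
  simp_rw [this]
  have hs : MeasurableSet {s : ℝ | geodesicPoint u v s ∈ Q} := hm hQ
  rw [lintegral_indicator_one hs]
  rfl

/-- The Crofton density in closed form. -/
noncomputable def croftonDensity (L G u v : ℝ) : ℝ :=
  L / (4 * G) * (1 / (2 * Real.sin ((v - u) / 2) ^ 2))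

/-- At fixed opening `d` the density is constant, and changing `u` rotates the geodesic rigidly.
Exchanging the `u` and `s` integrals leaves a circle average at the radius of the point with
parameter `s`. -/
theorem setLIntegral_chord_rotation {Q : Set ℂ} (hQ : MeasurableSet Q) (L G d : ℝ) :
    ∫⁻ u in Ioc 0 (0 + 2 * π),
        chordLength L Q u (u + d) * ENNReal.ofReal (croftonDensity L G u (u + d)) =
      ENNReal.ofReal L * ENNReal.ofReal (L / (4 * G) * (1 / (2 * Real.sin (d / 2) ^ 2))) *
        ∫⁻ s, circleSection Q
          √(Real.cos (d / 2) ^ 2 + Real.sin (d / 2) ^ 2 * Real.tanh s ^ 2) := by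
  have hd : ∀ u, croftonDensity L G u (u + d) =
      L / (4 * G) * (1 / (2 * Real.sin (d / 2) ^ 2)) := fun u => by
    simp [croftonDensity]
  simp_rw [hd, chordLength_eq_lintegral L hQ]
  rw [lintegral_mul_const' _ _ ENNReal.ofReal_ne_top, lintegral_const_mul' _ _ ENNReal.ofReal_ne_top]
  have hgm : Measurable fun p : ℝ × ℝ => geodesicPoint p.1 (p.1 + d) p.2 := by
    unfold geodesicPoint
    have := Real.measurable_tanh
    fun_prop
  have hm : Measurable fun p : ℝ × ℝ => (Q.indicator 1 (geodesicPoint p.1 (p.1 + d) p.2) : ℝ≥0∞) :=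
    (measurable_one.indicator hQ).comp hgm
  rw [lintegral_lintegral_swap hm.aemeasurable, mul_right_comm]
  congr 1
  refine lintegral_congr fun s => ?_
  have hg : ∀ u : ℝ, geodesicPoint u (u + d) s = Complex.exp ((u : ℂ) * Complex.I) *
      (Complex.exp (((d / 2 : ℝ) : ℂ) * Complex.I) *
        ((Real.cos (d / 2) : ℂ) + (Real.sin (d / 2) * Real.tanh s : ℝ) * Complex.I)) := by
    intro u
    unfold geodesicPoint
    have h1 : (u + (u + d)) / 2 = u + d / 2 := by ring
    rw [h1, add_sub_cancel_left, Complex.ofReal_add, add_mul, Complex.exp_add, mul_assoc]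
  simp_rw [hg]
  rw [setLIntegral_rotation, norm_mul, Complex.norm_exp_ofReal_mul_I, one_mul,
    Complex.norm_add_mul_I, mul_pow]

/-- Hyperbolic Pythagoras: with `sinh` of the distance to the centre equal to `t` at the foot point,
the point at arc length `s` has `cosh ρ = √(1 + t²) cosh s`. Taking `y = √(1 + t²) sinh s` gives
`sinh² ρ = t² + y²` and `ds = dy / cosh ρ`. -/
theorem lintegral_circleSection_sinh_substitution (Q : Set ℂ) (t : ℝ) :
    ∫⁻ s, circleSection Q
        √(Real.sin (arctan t) ^ 2 + Real.cos (arctan t) ^ 2 * Real.tanh s ^ 2) =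
      ∫⁻ y, ENNReal.ofReal (1 / √(1 + (t ^ 2 + y ^ 2))) *
        circleSection Q √((t ^ 2 + y ^ 2) / (1 + (t ^ 2 + y ^ 2))) := by
  have ht : 0 < 1 + t ^ 2 := by positivity
  set a := √(1 + t ^ 2) with ha
  have ha0 : 0 < a := Real.sqrt_pos.2 ht
  have ha2 : a ^ 2 = 1 + t ^ 2 := Real.sq_sqrt ht.le
  have hderiv : ∀ y : ℝ, HasDerivAt (fun y => arsinh (y / a)) (1 / √(1 + (t ^ 2 + y ^ 2))) y := by
    intro y
    convert! ((hasDerivAt_id y).div_const a).arsinh using 1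
    have h1 : 1 + (t ^ 2 + y ^ 2) = a ^ 2 * (1 + (y / a) ^ 2) := by
      field_simp; linarith
    simp only [id, smul_eq_mul]
    rw [h1, Real.sqrt_mul (sq_nonneg a), Real.sqrt_sq ha0.le]
    field_simp
  have himg : (fun y => arsinh (y / a)) '' univ = univ := by
    rw [image_univ, range_eq_univ]
    exact arsinh_surjective.comp fun x => ⟨x * a, by field_simp⟩
  have hinj : InjOn (fun y => arsinh (y / a)) univ := by
    intro x _ y _ h
    have h := arsinh_injective h
    field_simp at h
    exact h
  have key := lintegral_image_eq_lintegral_abs_deriv_mul MeasurableSet.univ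
    (fun y _ => (hderiv y).hasDerivWithinAt) hinj
    (fun s => circleSection Q
        √(Real.sin (arctan t) ^ 2 + Real.cos (arctan t) ^ 2 * Real.tanh s ^ 2))
  rw [himg, setLIntegral_univ, setLIntegral_univ] at key
  rw [key]
  refine lintegral_congr fun y => ?_
  rw [abs_of_nonneg (by positivity)]
  congr 3
  rw [Real.tanh_arsinh, Real.sin_arctan, Real.cos_arctan, div_pow, div_pow, div_pow, ← ha, ha2,
    Real.sq_sqrt (by positivity), div_pow, ha2]
  field_simp
  ring

/-- The integrand depends on `t² + y²` alone. With polar radius `r = sinh ρ` one has `r dr / √(1 +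
r²) = sinh ρ dρ`, and the polar angle contributes `2π`. -/
theorem lintegral_polar_circleSection {Q : Set ℂ} (hQ : MeasurableSet Q) :
    ∫⁻ t : ℝ, ∫⁻ y : ℝ, ENNReal.ofReal (1 / √(1 + (t ^ 2 + y ^ 2))) *
        circleSection Q √((t ^ 2 + y ^ 2) / (1 + (t ^ 2 + y ^ 2))) =
      ENNReal.ofReal (2 * π) *
        ∫⁻ ρ in Ioi 0, ENNReal.ofReal (Real.sinh ρ) * circleSection Q (Real.tanh ρ) := by
  have hcs := measurable_circleSection hQ
  set H : ℝ → ℝ≥0∞ := fun q => ENNReal.ofReal (1 / √(1 + q)) * circleSection Q √(q / (1 + q))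
    with hH
  have hHm : Measurable H := by fun_prop
  have hpol := lintegral_comp_polarCoord_symm fun p : ℝ × ℝ => H (p.1 ^ 2 + p.2 ^ 2)
  rw [Measure.volume_eq_prod, lintegral_prod _ (by fun_prop)] at hpol
  change ∫⁻ t : ℝ, ∫⁻ y : ℝ, H (t ^ 2 + y ^ 2) = _
  rw [← hpol]
  have h1 : ∀ p : ℝ × ℝ, ENNReal.ofReal p.1 • H ((polarCoord.symm p).1 ^ 2 +
      (polarCoord.symm p).2 ^ 2) = ENNReal.ofReal p.1 * H (p.1 ^ 2) := by
    intro p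
    rw [smul_eq_mul, polarCoord_symm_apply]
    congr 2
    linear_combination p.1 ^ 2 * Real.sin_sq_add_cos_sq p.2
  simp_rw [h1]
  rw [polarCoord_target, setLIntegral_prod _ (by fun_prop)]
  simp only [lintegral_const, Measure.restrict_apply MeasurableSet.univ, univ_inter,
    Real.volume_Ioo]
  rw [lintegral_mul_const _ (by fun_prop), mul_comm, show π - -π = 2 * π by ring]
  congr 1
  have himg : Real.sinh '' Ioi 0 = Ioi 0 := by
    ext x
    constructor
    · rintro ⟨y, hy, rfl⟩; exact Real.sinh_pos_iff.2 hy
    · intro hx; exact ⟨arsinh x, arsinh_pos_iff.2 hx, sinh_arsinh x⟩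
  have key := lintegral_image_eq_lintegral_abs_deriv_mul (measurableSet_Ioi (a := (0 : ℝ)))
    (fun y _ => (Real.hasDerivAt_sinh y).hasDerivWithinAt) Real.sinh_injective.injOn
    (fun r => ENNReal.ofReal r * H (r ^ 2))
  rw [himg] at key
  rw [key]
  refine setLIntegral_congr_fun measurableSet_Ioi fun ρ hρ => ?_
  have hs : 0 < Real.sinh ρ := Real.sinh_pos_iff.2 hρ
  have hc : 0 < Real.cosh ρ := Real.cosh_pos ρ
  have hcs2 : 1 + Real.sinh ρ ^ 2 = Real.cosh ρ ^ 2 := by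
    rw [Real.cosh_sq]; ring
  simp only [hH]
  rw [hcs2, Real.sqrt_sq hc.le, ← div_pow, Real.sqrt_sq (by positivity), abs_of_pos hc,
    ← Real.tanh_eq_sinh_div_cosh, ← mul_assoc, ← mul_assoc, ← ENNReal.ofReal_mul hc.le,
    ← ENNReal.ofReal_mul (by positivity)]
  congr 2
  field_simp

theorem setLIntegral_geodesicStrip_croftonDensity {Q : Set ℂ} (hQ : MeasurableSet Q) {L G : ℝ}
    (hL : 0 < L) (hG : 0 < G) :
    ∫⁻ p in geodesicStrip,
        chordLength L Q p.1 p.2 * ENNReal.ofReal (croftonDensity L G p.1 p.2) =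
      ENNReal.ofReal (π / (2 * G)) * sliceVolume L Q := by
  have hdm : Measurable fun p : ℝ × ℝ => croftonDensity L G p.1 p.2 := by
    unfold croftonDensity; fun_prop
  have hstrip := setLIntegral_geodesicStrip
    (f := fun u v => chordLength L Q u v * ENNReal.ofReal (croftonDensity L G u v))
    ((measurable_chordLength L hQ).mul hdm.ennreal_ofReal)
    (fun u v => by simp only [chordLength_add_two_pi, croftonDensity, add_sub_add_right_eq_sub]) 0
  rw [hstrip]
  simp_rw [setLIntegral_chord_rotation hQ]
  -- The substitution `d = π - 2 arctan t`, that is `t = cot (d / 2)`. Its Jacobian `2 / (1 + t²)`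
  -- cancels the factor `1 / (2 sin² (d / 2)) = (1 + t²) / 2` of the density.
  have hderiv : ∀ t : ℝ, HasDerivAt (fun t => π - 2 * arctan t) (-(2 * (1 / (1 + t ^ 2)))) t :=
    fun t => ((hasDerivAt_arctan t).const_mul 2).const_sub π
  have himg : (fun t => π - 2 * arctan t) '' univ = Ioo 0 (2 * π) := by
    ext d
    constructor
    · rintro ⟨t, -, rfl⟩
      have h1 := arctan_lt_pi_div_two t
      have h2 := neg_pi_div_two_lt_arctan t
      constructor <;> simp only <;> linarith
    · rintro ⟨h1, h2⟩
      refine ⟨Real.tan ((π - d) / 2), mem_univ _, ?_⟩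
      simp only
      rw [Real.arctan_tan (by linarith) (by linarith)]
      ring
  have hinj : InjOn (fun t => π - 2 * arctan t) univ := by
    intro x _ y _ h
    simp only at h
    exact arctan_injective (by linarith)
  rw [← himg, lintegral_image_eq_lintegral_abs_deriv_mul MeasurableSet.univ
    (fun t _ => (hderiv t).hasDerivWithinAt) hinj, setLIntegral_univ]
  have hpt : ∀ t : ℝ, ENNReal.ofReal |(-(2 * (1 / (1 + t ^ 2))))| *
      (ENNReal.ofReal L *
        ENNReal.ofReal (L / (4 * G) * (1 / (2 * Real.sin ((π - 2 * arctan t) / 2) ^ 2))) *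
        ∫⁻ s, circleSection Q √(Real.cos ((π - 2 * arctan t) / 2) ^ 2 +
          Real.sin ((π - 2 * arctan t) / 2) ^ 2 * Real.tanh s ^ 2)) =
      ENNReal.ofReal (L ^ 2 / (4 * G)) *
        ∫⁻ y, ENNReal.ofReal (1 / √(1 + (t ^ 2 + y ^ 2))) *
          circleSection Q √((t ^ 2 + y ^ 2) / (1 + (t ^ 2 + y ^ 2))) := by
    intro t
    rw [show (π - 2 * arctan t) / 2 = π / 2 - arctan t by ring, Real.cos_pi_div_two_sub,
      Real.sin_pi_div_two_sub, lintegral_circleSection_sinh_substitution, ← mul_assoc, abs_neg,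
      abs_of_nonneg (by positivity), ← ENNReal.ofReal_mul hL.le,
      ← ENNReal.ofReal_mul (by positivity)]
    congr 2
    rw [Real.cos_sq_arctan]
    field_simp
  simp_rw [hpt]
  rw [lintegral_const_mul' _ _ ENNReal.ofReal_ne_top, lintegral_polar_circleSection hQ,
    sliceVolume_eq_lintegral hQ, ← mul_assoc, ← mul_assoc, ← ENNReal.ofReal_mul (by positivity),
    ← ENNReal.ofReal_mul (by positivity)]
  congr 2
  field_simp
  ring

/-- The Crofton formula: the volume of a measurable region is its kinematic space integral. -/
theorem setLIntegral_kinematicRegion {Q : Set ℂ} (hQ : MeasurableSet Q) {L G ε : ℝ}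
    (hL : 0 < L) (hG : 0 < G) (hε : 0 < ε) :
    ∫⁻ p in kinematicRegion Q, chordLength L Q p.1 p.2 * ENNReal.ofReal (crofton L G ε p.1 p.2) =
      ENNReal.ofReal (π / (2 * G)) * sliceVolume L Q := by
  rw [← setLIntegral_geodesicStrip_croftonDensity hQ hL hG]
  have hdm : Measurable fun p : ℝ × ℝ => croftonDensity L G p.1 p.2 := by
    unfold croftonDensity; fun_prop
  have hcm := measurable_chordLength L hQ
  set F := fun p : ℝ × ℝ => chordLength L Q p.1 p.2 * ENNReal.ofReal (croftonDensity L G p.1 p.2)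
    with hF
  have hFm : Measurable F := hcm.mul hdm.ennreal_ofReal
  have hsub : kinematicRegion Q ⊆ geodesicStrip := fun p hp =>
    ⟨hp.1, hp.2.1, hp.2.2.1, hp.2.2.2.1⟩
  -- Measurability of `kinematicRegion Q`, a projection, is never needed: it lies between the
  -- measurable set where the integrand is nonzero and the whole strip, and these two give the same
  -- integral.
  have hsub' : geodesicStrip ∩ {p | F p ≠ 0} ⊆ kinematicRegion Q := by
    rintro p ⟨⟨h1, h2, h3, h4⟩, hp⟩
    refine ⟨h1, h2, h3, h4, ?_⟩
    by_contra! hne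
    apply hp
    simp [hF, chordLength, hne]
  have hfin : ∀ p ∈ geodesicStrip,
      chordLength L Q p.1 p.2 * ENNReal.ofReal (crofton L G ε p.1 p.2) = F p := by
    rintro p ⟨h1, h2, h3, h4⟩
    rw [crofton_eq L G ε hε (sin_half_sub_pos (by linarith) (by linarith)).ne']
    rfl
  have hmeas : MeasurableSet (geodesicStrip ∩ {p | F p ≠ 0}) :=
    measurableSet_geodesicStrip.inter (hFm (measurableSet_singleton 0).compl)
  have hle : ∀ s ⊆ geodesicStrip, ∫⁻ p in s,
      chordLength L Q p.1 p.2 * ENNReal.ofReal (crofton L G ε p.1 p.2) = ∫⁻ p in s, F p := by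
    intro s hs
    refine lintegral_congr_ae ?_
    have := ae_restrict_mem (μ := volume) measurableSet_geodesicStrip
    filter_upwards [ae_restrict_of_ae_restrict_of_subset hs this] with p hp
    exact hfin p hp
  rw [hle _ hsub]
  refine le_antisymm (lintegral_mono_set hsub) ?_
  calc ∫⁻ p in geodesicStrip, F p = ∫⁻ p in geodesicStrip ∩ {p | F p ≠ 0}, F p := by
        rw [← lintegral_indicator measurableSet_geodesicStrip, ← lintegral_indicator hmeas]
        refine lintegral_congr fun p => ?_
        by_cases h1 : p ∈ geodesicStrip
        · by_cases h2 : F p = 0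
          · simp [indicator, h2]
          · rw [indicator_of_mem h1, indicator_of_mem (mem_inter h1 h2)]
        · rw [indicator_of_notMem h1, indicator_of_notMem fun h => h1 h.1]
    _ ≤ ∫⁻ p in kinematicRegion Q, F p := lintegral_mono_set hsub'

/-! ### The volume of an ideal quadrilateral -/

/-- The volume, per unit angle, of the part of `Q` in the direction `χ`. -/
noncomputable def radialVolume (Q : Set ℂ) (χ : ℝ) : ℝ≥0∞ :=
  ∫⁻ ρ in Ioi 0, ENNReal.ofReal (Real.sinh ρ) * Q.indicator 1 (bulkPoint ρ χ)

theorem bulkPoint_add_two_pi (ρ χ : ℝ) : bulkPoint ρ (χ + 2 * π) = bulkPoint ρ χ := by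
  have h := exp_periodic χ
  simp only at h
  rw [bulkPoint, h, bulkPoint]

theorem sliceVolume_eq_lintegral_radialVolume {Q : Set ℂ} (hQ : MeasurableSet Q) (L c : ℝ) :
    sliceVolume L Q =
      ENNReal.ofReal (L ^ 2) * ∫⁻ χ in Ioc c (c + 2 * π), radialVolume Q χ := by
  have hper : Function.Periodic (radialVolume Q) (2 * π) := fun χ => by
    simp only [radialVolume, bulkPoint_add_two_pi]
  rw [sliceVolume_eq_lintegral hQ, setLIntegral_Ioc_eq_of_periodic Real.two_pi_pos hper c 0, zero_add]
  congr 1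
  have hb : Measurable fun p : ℝ × ℝ => bulkPoint p.2 p.1 := by
    unfold bulkPoint
    have := Real.measurable_tanh
    fun_prop
  have hi : Measurable fun p : ℝ × ℝ => (Q.indicator 1 (bulkPoint p.2 p.1) : ℝ≥0∞) :=
    (measurable_one.indicator hQ).comp hb
  have hm : Measurable fun p : ℝ × ℝ =>
      ENNReal.ofReal (Real.sinh p.2) * (Q.indicator 1 (bulkPoint p.2 p.1) : ℝ≥0∞) :=
    Measurable.mul (by fun_prop) hi
  unfold radialVolume
  rw [lintegral_lintegral_swap hm.aemeasurable]
  refine lintegral_congr fun ρ => ?_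
  rw [lintegral_const_mul' _ _ ENNReal.ofReal_ne_top]
  rfl

/-! ### The causal shadow in cylindrical coordinates -/

theorem bulkPoint_mem_intervalRegion {ρ χ u v : ℝ} :
    bulkPoint ρ χ ∈ intervalRegion u v ↔
      Real.cos ((v - u) / 2) < Real.tanh ρ * Real.cos (χ - (u + v) / 2) := by
  have h1 : ‖bulkPoint ρ χ‖ < 1 := by
    rw [bulkPoint, norm_mul, Complex.norm_exp_ofReal_mul_I, mul_one, Complex.norm_real,
      Real.norm_eq_abs, abs_lt]
    exact ⟨Real.neg_one_lt_tanh ρ, Real.tanh_lt_one ρ⟩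
  have h2 : bulkPoint ρ χ * Complex.exp (-((u + v) / 2 : ℝ) * Complex.I) =
      (Real.tanh ρ : ℂ) * Complex.exp ((χ - (u + v) / 2 : ℝ) * Complex.I) := by
    rw [bulkPoint, mul_assoc, ← Complex.exp_add]
    congr 2
    push_cast
    ring
  simp only [intervalRegion, mem_ofPred_eq, h1, true_and]
  rw [h2, Complex.re_ofReal_mul, Complex.exp_ofReal_mul_I_re]

theorem bulkPoint_mem_causalShadow {ρ χ a₁ b₁ a₂ b₂ : ℝ} :
    bulkPoint ρ χ ∈ causalShadow a₁ b₁ a₂ b₂ ↔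
      Real.tanh ρ * Real.cos (χ - (a₁ + b₁) / 2) ≤ Real.cos ((b₁ - a₁) / 2) ∧
      Real.tanh ρ * Real.cos (χ - (b₁ + a₂) / 2) ≤ Real.cos ((a₂ - b₁) / 2) ∧
      Real.tanh ρ * Real.cos (χ - (a₂ + b₂) / 2) ≤ Real.cos ((b₂ - a₂) / 2) ∧
      Real.tanh ρ * Real.cos (χ - (b₂ + (a₁ + 2 * π)) / 2) ≤
        Real.cos ((a₁ + 2 * π - b₂) / 2) := by
  have h1 : ‖bulkPoint ρ χ‖ < 1 := by
    rw [bulkPoint, norm_mul, Complex.norm_exp_ofReal_mul_I, mul_one, Complex.norm_real,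
      Real.norm_eq_abs, abs_lt]
    exact ⟨Real.neg_one_lt_tanh ρ, Real.tanh_lt_one ρ⟩
  simp only [causalShadow, mem_ofPred_eq, h1, true_and, bulkPoint_mem_intervalRegion, not_lt]

theorem measurableSet_intervalRegion (u v : ℝ) : MeasurableSet (intervalRegion u v) := by
  refine (measurableSet_lt (f := fun z : ℂ => ‖z‖) (by fun_prop) measurable_const).inter
    (measurableSet_lt measurable_const (Complex.measurable_re.comp (by fun_prop)))

theorem measurableSet_causalShadow (a₁ b₁ a₂ b₂ : ℝ) :
    MeasurableSet (causalShadow a₁ b₁ a₂ b₂) :=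
  (measurableSet_lt (f := fun z : ℂ => ‖z‖) (by fun_prop) measurable_const).inter
    ((measurableSet_intervalRegion _ _).compl.inter
      ((measurableSet_intervalRegion _ _).compl.inter
        ((measurableSet_intervalRegion _ _).compl.inter (measurableSet_intervalRegion _ _).compl)))

theorem intervalRegion_add_two_pi (u v : ℝ) :
    intervalRegion (u + 2 * π) (v + 2 * π) = intervalRegion u v := by
  have h1 : v + 2 * π - (u + 2 * π) = v - u := by ring
  have h2 : Complex.exp (-((u + 2 * π + (v + 2 * π)) / 2 : ℝ) * Complex.I) =
      Complex.exp (-((u + v) / 2 : ℝ) * Complex.I) := by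
    rw [← Complex.exp_periodic.sub_eq (-((u + v) / 2 : ℝ) * Complex.I)]
    congr 1
    push_cast
    ring
  simp only [intervalRegion, h1, h2]

theorem causalShadow_rotate (a₁ b₁ a₂ b₂ : ℝ) :
    causalShadow a₁ b₁ a₂ b₂ = causalShadow b₁ a₂ b₂ (a₁ + 2 * π) := by
  ext z
  simp only [causalShadow, mem_ofPred_eq, intervalRegion_add_two_pi]
  tauto

theorem cos_half_lt_cos_sub {u v χ : ℝ} (hv : v ≤ u + 2 * π) (h1 : u < χ) (h2 : χ < v) :
    Real.cos ((v - u) / 2) < Real.cos (χ - (u + v) / 2) := by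
  rw [← Real.cos_abs (χ - (u + v) / 2)]
  exact Real.cos_lt_cos_of_nonneg_of_le_pi (abs_nonneg _) (by linarith)
    (abs_lt.2 ⟨by linarith, by linarith⟩)

/-- Outside the interval, `χ` is within `π - (v - u) / 2` of the antipode of its centre. -/
theorem cos_sub_le_cos_half {u v χ : ℝ} (huv : u ≤ v) (h1 : v ≤ χ) (h2 : χ ≤ u + 2 * π) :
    Real.cos (χ - (u + v) / 2) ≤ Real.cos ((v - u) / 2) := by
  have h3 : Real.cos (π - (v - u) / 2) ≤ Real.cos |χ - (u + v) / 2 - π| :=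
    Real.cos_le_cos_of_nonneg_of_le_pi (abs_nonneg _) (by linarith)
      (abs_le.2 ⟨by linarith, by linarith⟩)
  rw [Real.cos_abs, Real.cos_pi_sub, Real.cos_sub_pi] at h3
  linarith

theorem cos_sub_le_cos_half_left {u v χ : ℝ} (huv : u ≤ v) (h1 : v ≤ χ + 2 * π) (h2 : χ ≤ u) :
    Real.cos (χ - (u + v) / 2) ≤ Real.cos ((v - u) / 2) := by
  have h := cos_sub_le_cos_half huv h1 (by linarith)
  rwa [show χ + 2 * π - (u + v) / 2 = χ - (u + v) / 2 + 2 * π by ring, Real.cos_add_two_pi] at h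

/-- The constraint of a geodesic that does not separate the centre from its interval is void
outside the sector over that interval. -/
theorem tanh_mul_le_of_le {ρ c k : ℝ} (hρ : 0 < ρ) (hk : 0 ≤ k) (h : c ≤ k) :
    Real.tanh ρ * c ≤ k := by
  have h0 : 0 ≤ Real.tanh ρ := by
    rw [Real.tanh_eq_sinh_div_cosh]
    exact div_nonneg (Real.sinh_nonneg_iff.2 hρ.le) (Real.cosh_pos ρ).le
  have h1 := Real.tanh_lt_one ρ
  nlinarith

/-- For an interval longer than `π` the removed region contains the whole open sector over it: `tanh
ρ * c` is nonnegative when `c` is, and otherwise at least `c`. -/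
theorem lt_tanh_mul_of_neg {ρ c k : ℝ} (hρ : 0 < ρ) (hk : k < 0) (h : k < c) :
    k < Real.tanh ρ * c := by
  have h0 : 0 ≤ Real.tanh ρ := by
    rw [Real.tanh_eq_sinh_div_cosh]
    exact div_nonneg (Real.sinh_nonneg_iff.2 hρ.le) (Real.cosh_pos ρ).le
  have h1 := Real.tanh_lt_one ρ
  nlinarith

/-- `cosh ρ` at the point of the geodesic `(u, v)` in the direction `χ`. -/
noncomputable def geodesicCosh (u v χ : ℝ) : ℝ :=
  Real.cos (χ - (u + v) / 2) /
    √(Real.cos (χ - (u + v) / 2) ^ 2 - Real.cos ((v - u) / 2) ^ 2)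

/-- A primitive is `arcsin (sin (χ - θ) / sin α)`, which runs from `-π/2` to `π/2`. The integrand
may blow up at the ends; being the nonnegative derivative of a function continuous up to the ends
makes it integrable. -/
theorem integral_geodesicCosh {u v : ℝ} (huv : u < v) (hv : v ≤ u + π) :
    IntegrableOn (geodesicCosh u v) (Ioc u v) ∧ ∫ χ in Ioc u v, geodesicCosh u v χ = π := by
  set α := (v - u) / 2 with hα
  set θ := (u + v) / 2 with hθ
  have hS : 0 < Real.sin α := Real.sin_pos_of_pos_of_lt_pi (by linarith) (by linarith)
  have hcont : ContinuousOn (fun χ => arcsin (Real.sin (χ - θ) / Real.sin α)) (Icc u v) :=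
    Continuous.continuousOn (by fun_prop)
  have hderiv : ∀ χ ∈ Ioo u v,
      HasDerivAt (fun χ => arcsin (Real.sin (χ - θ) / Real.sin α)) (geodesicCosh u v χ) χ := by
    rintro χ ⟨h1, h2⟩
    have hlt : Real.sin (χ - θ) < Real.sin α :=
      Real.sin_lt_sin_of_lt_of_le_pi_div_two (by linarith) (by linarith) (by linarith)
    have hgt : -Real.sin α < Real.sin (χ - θ) := by
      rw [← Real.sin_neg]
      exact Real.sin_lt_sin_of_lt_of_le_pi_div_two (by linarith) (by linarith) (by linarith)
    have hx1 : Real.sin (χ - θ) / Real.sin α ≠ -1 := by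
      intro h; rw [div_eq_iff hS.ne'] at h; linarith
    have hx2 : Real.sin (χ - θ) / Real.sin α ≠ 1 := by
      intro h; rw [div_eq_iff hS.ne'] at h; linarith
    have hd := (hasDerivAt_arcsin hx1 hx2).comp χ
      ((((hasDerivAt_id χ).sub_const θ).sin).div_const (Real.sin α))
    convert! hd using 1
    have e1 : Real.cos (χ - θ) ^ 2 - Real.cos α ^ 2 =
        Real.sin α ^ 2 * (1 - (Real.sin (χ - θ) / Real.sin α) ^ 2) := by
      rw [Real.cos_sq', Real.cos_sq']
      field_simp
      ring
    simp only [id, mul_one]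
    rw [geodesicCosh, ← hα, ← hθ, e1, Real.sqrt_mul (sq_nonneg _), Real.sqrt_sq hS.le]
    have : 0 < 1 - (Real.sin (χ - θ) / Real.sin α) ^ 2 := by
      have : 0 < Real.sin α ^ 2 - Real.sin (χ - θ) ^ 2 := by nlinarith
      rw [div_pow, sub_pos, div_lt_one (by positivity)]
      linarith
    have := Real.sqrt_pos.2 this
    field_simp
  have hpos : ∀ χ ∈ Ioo u v, 0 ≤ geodesicCosh u v χ := fun χ h =>
    div_nonneg (Real.cos_nonneg_of_mem_Icc ⟨by linarith [h.1], by linarith [h.2]⟩)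
      (Real.sqrt_nonneg _)
  have hint := intervalIntegral.integrableOn_deriv_of_nonneg hcont hderiv hpos
  refine ⟨hint, ?_⟩
  rw [← intervalIntegral.integral_of_le huv.le,
    intervalIntegral.integral_eq_sub_of_hasDerivAt_of_le huv.le hcont hderiv
      ((intervalIntegrable_iff_integrableOn_Ioc_of_le huv.le).2 hint)]
  rw [show v - θ = α by rw [hα, hθ]; ring, show u - θ = -α by rw [hα, hθ]; ring, Real.sin_neg,
    neg_div, div_self hS.ne', arcsin_one, arcsin_neg, arcsin_one]
  ring

theorem setLIntegral_sinh {a b : ℝ} (ha : 0 ≤ a) (hab : a ≤ b) :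
    ∫⁻ ρ in Ioc a b, ENNReal.ofReal (Real.sinh ρ) =
      ENNReal.ofReal (Real.cosh b - Real.cosh a) := by
  have hi : IntervalIntegrable Real.sinh volume a b := Real.continuous_sinh.intervalIntegrable a b
  rw [← ofReal_integral_eq_lintegral_ofReal
    ((intervalIntegrable_iff_integrableOn_Ioc_of_le hab).1 hi)
    ((ae_restrict_iff' measurableSet_Ioc).2 (Filter.Eventually.of_forall fun ρ hρ =>
      Real.sinh_nonneg_iff.2 (ha.trans hρ.1.le))),
    ← intervalIntegral.integral_of_le hab,
    intervalIntegral.integral_eq_sub_of_hasDerivAt (fun x _ => Real.hasDerivAt_cosh x) hi]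

theorem tanh_le_iff {ρ x : ℝ} (hx : x ∈ Ioo (-1) 1) : Real.tanh ρ ≤ x ↔ ρ ≤ artanh x := by
  conv_rhs => rw [← artanh_tanh ρ]
  rw [artanh_le_artanh_iff ⟨Real.neg_one_lt_tanh ρ, Real.tanh_lt_one ρ⟩ hx]

theorem le_tanh_iff {ρ x : ℝ} (hx : x ∈ Ioo (-1) 1) : x ≤ Real.tanh ρ ↔ artanh x ≤ ρ := by
  conv_rhs => rw [← artanh_tanh ρ]
  rw [artanh_le_artanh_iff hx ⟨Real.neg_one_lt_tanh ρ, Real.tanh_lt_one ρ⟩]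

theorem cosh_artanh_div {c k : ℝ} (hk : 0 ≤ k) (hc : k < c) :
    Real.cosh (artanh (k / c)) = c / √(c ^ 2 - k ^ 2) := by
  have hc0 : 0 < c := hk.trans_lt hc
  have h0 : 0 ≤ k / c := by positivity
  have h1 : k / c < 1 := (div_lt_one hc0).2 hc
  rw [cosh_artanh ⟨by linarith, h1⟩]
  have : 1 - (k / c) ^ 2 = (c ^ 2 - k ^ 2) / c ^ 2 := by field_simp
  rw [this, Real.sqrt_div' _ (sq_nonneg c), Real.sqrt_sq hc0.le, one_div_div]

theorem radialVolume_of_forall_mem_iff {Q : Set ℂ} {χ a b : ℝ} (ha : 0 ≤ a) (hab : a ≤ b)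
    (h : ∀ ρ, 0 < ρ → (bulkPoint ρ χ ∈ Q ↔ a ≤ ρ ∧ ρ ≤ b)) :
    radialVolume Q χ = ENNReal.ofReal (Real.cosh b - Real.cosh a) := by
  rw [← setLIntegral_sinh ha hab, radialVolume, ← lintegral_indicator measurableSet_Ioi,
    ← lintegral_indicator measurableSet_Ioc]
  refine lintegral_congr_ae ?_
  -- Membership in `Q` is the closed condition `a ≤ ρ ≤ b`, while the integral is over `Ioc a b`;
  -- the point `ρ = a` is discarded.
  filter_upwards [measure_eq_zero_iff_ae_notMem.1 (measure_singleton (μ := volume) a)] with ρ hρ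
  have hρ : ρ ≠ a := hρ
  by_cases h0 : 0 < ρ
  · rw [indicator_of_mem (show ρ ∈ Ioi 0 from h0)]
    by_cases hm : a ≤ ρ ∧ ρ ≤ b
    · rw [indicator_of_mem ((h ρ h0).2 hm), 
        indicator_of_mem (show ρ ∈ Ioc a b from ⟨lt_of_le_of_ne hm.1 hρ.symm, hm.2⟩)]
      simp
    · rw [indicator_of_notMem (mt (h ρ h0).1 hm),
        indicator_of_notMem fun h' => hm ⟨h'.1.le, h'.2⟩, mul_zero]
  · rw [indicator_of_notMem (show ρ ∉ Ioi 0 from h0),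
      indicator_of_notMem fun h' => h0 (ha.trans_lt h'.1)]

theorem ae_restrict_Ioc_mem_Ioo (u v : ℝ) : ∀ᵐ χ ∂volume.restrict (Ioc u v), χ ∈ Ioo u v := by
  rw [← restrict_Ioo_eq_restrict_Ioc]
  exact ae_restrict_mem measurableSet_Ioo

theorem div_mem_Ioo {c k : ℝ} (hk : 0 ≤ k) (hc : k < c) : k / c ∈ Ioo (-1 : ℝ) 1 := by
  have hc0 : 0 < c := hk.trans_lt hc
  have h0 : 0 ≤ k / c := by positivity
  exact ⟨by linarith, (div_lt_one hc0).2 hc⟩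

/-- The sector over an interval between the centre and the geodesic of the interval is a triangle
with angles `v - u`, `0`, `0`. -/
theorem setLIntegral_radialVolume_sector {Q : Set ℂ} {u v : ℝ} (huv : u < v) (hv : v ≤ u + π)
    (h : ∀ χ ∈ Ioo u v, ∀ ρ, 0 < ρ → (bulkPoint ρ χ ∈ Q ↔
      Real.tanh ρ * Real.cos (χ - (u + v) / 2) ≤ Real.cos ((v - u) / 2))) :
    ∫⁻ χ in Ioc u v, radialVolume Q χ = ENNReal.ofReal (π - (v - u)) := by
  obtain ⟨hint, hval⟩ := integral_geodesicCosh huv hv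
  have hk : 0 ≤ Real.cos ((v - u) / 2) :=
    Real.cos_nonneg_of_mem_Icc ⟨by linarith [pi_pos], by linarith⟩
  have hpt : ∀ χ ∈ Ioo u v, 1 ≤ geodesicCosh u v χ ∧
      radialVolume Q χ = ENNReal.ofReal (geodesicCosh u v χ - 1) := by
    intro χ hχ
    have hc := cos_half_lt_cos_sub (by linarith [pi_pos]) hχ.1 hχ.2
    have hR : 0 ≤ artanh (Real.cos ((v - u) / 2) / Real.cos (χ - (u + v) / 2)) :=
      artanh_nonneg (div_nonneg hk (hk.trans hc.le))
    have hcosh := cosh_artanh_div hk hc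
    constructor
    · rw [geodesicCosh, ← hcosh]; exact Real.one_le_cosh _
    · rw [geodesicCosh, ← hcosh, ← Real.cosh_zero]
      refine radialVolume_of_forall_mem_iff le_rfl hR fun ρ hρ => ?_
      rw [h χ hχ ρ hρ, ← le_div_iff₀ (hk.trans_lt hc), tanh_le_iff (div_mem_Ioo hk hc)]
      exact ⟨fun h => ⟨hρ.le, h⟩, fun h => h.2⟩
  have hone : IntegrableOn (fun _ : ℝ => (1 : ℝ)) (Ioc u v) := integrableOn_const (by simp)
  have hsub : IntegrableOn (fun χ => geodesicCosh u v χ - 1) (Ioc u v) := hint.sub hone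
  have hae := ae_restrict_Ioc_mem_Ioo u v
  rw [lintegral_congr_ae (hae.mono fun χ hχ => (hpt χ hχ).2),
    ← ofReal_integral_eq_lintegral_ofReal hsub
      (hae.mono fun χ hχ => sub_nonneg.2 (hpt χ hχ).1), integral_sub hint hone, hval]
  simp [huv.le]

/-- In each direction the geodesic of a subinterval is farther from the centre. Write the half-angle
products as `C`, `S` for `(u, v)` and `C'`, `S'` for `(U, V)`: the claim `(C' - S') (C + S) ≤ (C -
S) (C' + S')` reduces to `C' S ≤ C S'`, and both factors compare. -/
theorem cos_mul_cos_le_of_subinterval {u v U V χ : ℝ} (hU : U ≤ u) (h1 : u ≤ χ) (h2 : χ ≤ v)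
    (hV : v ≤ V) (hUV : V ≤ U + π) :
    Real.cos ((V - U) / 2) * Real.cos (χ - (u + v) / 2) ≤
      Real.cos ((v - u) / 2) * Real.cos (χ - (U + V) / 2) := by
  have hp := pi_pos
  have e1 : (V - U) / 2 = (χ - U) / 2 + (V - χ) / 2 := by ring
  have e2 : χ - (u + v) / 2 = (χ - u) / 2 - (v - χ) / 2 := by ring
  have e3 : (v - u) / 2 = (χ - u) / 2 + (v - χ) / 2 := by ring
  have e4 : χ - (U + V) / 2 = (χ - U) / 2 - (V - χ) / 2 := by ring
  rw [e1, e2, e3, e4, Real.cos_add, Real.cos_sub, Real.cos_add, Real.cos_sub]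
  have c1 : Real.cos ((χ - U) / 2) ≤ Real.cos ((χ - u) / 2) :=
    Real.cos_le_cos_of_nonneg_of_le_pi (by linarith) (by linarith) (by linarith)
  have c2 : Real.cos ((V - χ) / 2) ≤ Real.cos ((v - χ) / 2) :=
    Real.cos_le_cos_of_nonneg_of_le_pi (by linarith) (by linarith) (by linarith)
  have c3 : 0 ≤ Real.cos ((χ - U) / 2) := Real.cos_nonneg_of_mem_Icc ⟨by linarith, by linarith⟩
  have c4 : 0 ≤ Real.cos ((V - χ) / 2) := Real.cos_nonneg_of_mem_Icc ⟨by linarith, by linarith⟩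
  have s1 : Real.sin ((χ - u) / 2) ≤ Real.sin ((χ - U) / 2) :=
    Real.sin_le_sin_of_le_of_le_pi_div_two (by linarith) (by linarith) (by linarith)
  have s2 : Real.sin ((v - χ) / 2) ≤ Real.sin ((V - χ) / 2) :=
    Real.sin_le_sin_of_le_of_le_pi_div_two (by linarith) (by linarith) (by linarith)
  have s3 : 0 ≤ Real.sin ((χ - u) / 2) := Real.sin_nonneg_of_nonneg_of_le_pi (by linarith) (by linarith)
  have s4 : 0 ≤ Real.sin ((v - χ) / 2) := Real.sin_nonneg_of_nonneg_of_le_pi (by linarith) (by linarith)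
  have hC := mul_le_mul c1 c2 c4 (c3.trans c1)
  have hS := mul_le_mul s1 s2 s4 (s3.trans s1)
  have hCS := mul_le_mul hC hS (mul_nonneg s3 s4) (mul_nonneg (c3.trans c1) (c4.trans c2))
  linarith

/-- The region between two nested geodesics. The inner term is left as an integral because only the
sum over the three subintervals has a simple value; nonnegativity is recorded so that the
`ENNReal.ofReal` terms can be added. -/
theorem setLIntegral_radialVolume_strip {Q : Set ℂ} {u v U V : ℝ} (huv : u < v) (hU : U ≤ u)
    (hV : v ≤ V) (hUV : V ≤ U + π)
    (h : ∀ χ ∈ Ioo u v, ∀ ρ, 0 < ρ → (bulkPoint ρ χ ∈ Q ↔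
      Real.tanh ρ * Real.cos (χ - (u + v) / 2) ≤ Real.cos ((v - u) / 2) ∧
      Real.cos ((V - U) / 2) ≤ Real.tanh ρ * Real.cos (χ - (U + V) / 2))) :
    0 ≤ π - ∫ χ in Ioc u v, geodesicCosh U V χ ∧
    ∫⁻ χ in Ioc u v, radialVolume Q χ =
      ENNReal.ofReal (π - ∫ χ in Ioc u v, geodesicCosh U V χ) := by
  obtain ⟨hint, hval⟩ := integral_geodesicCosh huv (by linarith)
  have hint' := (integral_geodesicCosh (u := U) (v := V) (by linarith) hUV).1.mono_set
    (Ioc_subset_Ioc hU hV)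
  have hk : 0 ≤ Real.cos ((v - u) / 2) :=
    Real.cos_nonneg_of_mem_Icc ⟨by linarith [pi_pos], by linarith⟩
  have hK : 0 ≤ Real.cos ((V - U) / 2) :=
    Real.cos_nonneg_of_mem_Icc ⟨by linarith [pi_pos], by linarith⟩
  have hpt : ∀ χ ∈ Ioo u v, geodesicCosh U V χ ≤ geodesicCosh u v χ ∧
      radialVolume Q χ = ENNReal.ofReal (geodesicCosh u v χ - geodesicCosh U V χ) := by
    intro χ hχ
    have hc := cos_half_lt_cos_sub (by linarith [pi_pos]) hχ.1 hχ.2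
    have hC : Real.cos ((V - U) / 2) < Real.cos (χ - (U + V) / 2) :=
      cos_half_lt_cos_sub (by linarith [pi_pos]) (hU.trans_lt hχ.1) (hχ.2.trans_le hV)
    have hR : 0 ≤ artanh (Real.cos ((V - U) / 2) / Real.cos (χ - (U + V) / 2)) :=
      artanh_nonneg (div_nonneg hK (hK.trans hC.le))
    have hle : artanh (Real.cos ((V - U) / 2) / Real.cos (χ - (U + V) / 2)) ≤
        artanh (Real.cos ((v - u) / 2) / Real.cos (χ - (u + v) / 2)) := by
      rw [artanh_le_artanh_iff (div_mem_Ioo hK hC) (div_mem_Ioo hk hc),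
        div_le_div_iff₀ (hK.trans_lt hC) (hk.trans_lt hc)]
      exact cos_mul_cos_le_of_subinterval hU hχ.1.le hχ.2.le hV hUV
    have hcosh := cosh_artanh_div hk hc
    have hcosh' := cosh_artanh_div hK hC
    constructor
    · rw [geodesicCosh, geodesicCosh, ← hcosh, ← hcosh', Real.cosh_le_cosh,
        abs_of_nonneg hR, abs_of_nonneg (hR.trans hle)]
      exact hle
    · rw [geodesicCosh, geodesicCosh, ← hcosh, ← hcosh']
      refine radialVolume_of_forall_mem_iff hR hle fun ρ hρ => ?_
      rw [h χ hχ ρ hρ, ← le_div_iff₀ (hk.trans_lt hc), tanh_le_iff (div_mem_Ioo hk hc),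
        ← div_le_iff₀ (hK.trans_lt hC), le_tanh_iff (div_mem_Ioo hK hC), and_comm]
  have hae := ae_restrict_Ioc_mem_Ioo u v
  have hnn : 0 ≤ᵐ[volume.restrict (Ioc u v)]
      fun χ => geodesicCosh u v χ - geodesicCosh U V χ :=
    hae.mono fun χ hχ => sub_nonneg.2 (hpt χ hχ).1
  constructor
  · rw [← hval, ← integral_sub hint hint']
    exact integral_nonneg_of_ae hnn
  · have hsub : IntegrableOn (fun χ => geodesicCosh u v χ - geodesicCosh U V χ) (Ioc u v) :=
      hint.sub hint'
    rw [lintegral_congr_ae (hae.mono fun χ hχ => (hpt χ hχ).2),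
      ← ofReal_integral_eq_lintegral_ofReal hsub hnn, integral_sub hint hint', hval]

theorem setLIntegral_Ioc_add_Ioc {a b c : ℝ} (f : ℝ → ℝ≥0∞) (hab : a ≤ b) (hbc : b ≤ c) :
    ∫⁻ x in Ioc a c, f x = (∫⁻ x in Ioc a b, f x) + ∫⁻ x in Ioc b c, f x := by
  rw [← Ioc_union_Ioc_eq_Ioc hab hbc,
    lintegral_union measurableSet_Ioc (Ioc_disjoint_Ioc_of_le le_rfl)]

theorem cos_half_nonneg {u v : ℝ} (huv : u < v) (h : v ≤ u + π) : 0 ≤ Real.cos ((v - u) / 2) :=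
  Real.cos_nonneg_of_mem_Icc ⟨by linarith [pi_pos], by linarith⟩

/-- The centre belongs to the shadow. In the sector over one interval the three other constraints
are void, so each sector is a triangle with two ideal vertices. -/
theorem lintegral_radialVolume_causalShadow_of_le {a₁ b₁ a₂ b₂ : ℝ} (h₁ : a₁ < b₁) (h₂ : b₁ < a₂)
    (h₃ : a₂ < b₂) (h₄ : b₂ < a₁ + 2 * π) (w₁ : b₁ ≤ a₁ + π) (w₂ : a₂ ≤ b₁ + π)
    (w₃ : b₂ ≤ a₂ + π) (w₄ : a₁ + 2 * π ≤ b₂ + π) :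
    ∫⁻ χ in Ioc a₁ (a₁ + 2 * π), radialVolume (causalShadow a₁ b₁ a₂ b₂) χ =
      ENNReal.ofReal (2 * π) := by
  have k₁ := cos_half_nonneg h₁ w₁
  have k₂ := cos_half_nonneg h₂ w₂
  have k₃ := cos_half_nonneg h₃ w₃
  have k₄ := cos_half_nonneg h₄ w₄
  have i₁ := setLIntegral_radialVolume_sector (Q := causalShadow a₁ b₁ a₂ b₂) h₁ w₁ (by
    rintro χ ⟨hχ, hχ'⟩ ρ hρ
    rw [bulkPoint_mem_causalShadow]
    refine ⟨fun h => h.1, fun h => ⟨h, ?_, ?_, ?_⟩⟩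
    · exact tanh_mul_le_of_le hρ k₂ (cos_sub_le_cos_half_left h₂.le (by linarith) (by linarith))
    · exact tanh_mul_le_of_le hρ k₃ (cos_sub_le_cos_half_left h₃.le (by linarith) (by linarith))
    · exact tanh_mul_le_of_le hρ k₄ (cos_sub_le_cos_half_left h₄.le (by linarith) (by linarith)))
  have i₂ := setLIntegral_radialVolume_sector (Q := causalShadow a₁ b₁ a₂ b₂) h₂ w₂ (by
    rintro χ ⟨hχ, hχ'⟩ ρ hρ
    rw [bulkPoint_mem_causalShadow]
    refine ⟨fun h => h.2.1, fun h => ⟨?_, h, ?_, ?_⟩⟩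
    · exact tanh_mul_le_of_le hρ k₁ (cos_sub_le_cos_half h₁.le (by linarith) (by linarith))
    · exact tanh_mul_le_of_le hρ k₃ (cos_sub_le_cos_half_left h₃.le (by linarith) (by linarith))
    · exact tanh_mul_le_of_le hρ k₄ (cos_sub_le_cos_half_left h₄.le (by linarith) (by linarith)))
  have i₃ := setLIntegral_radialVolume_sector (Q := causalShadow a₁ b₁ a₂ b₂) h₃ w₃ (by
    rintro χ ⟨hχ, hχ'⟩ ρ hρ
    rw [bulkPoint_mem_causalShadow]
    refine ⟨fun h => h.2.2.1, fun h => ⟨?_, ?_, h, ?_⟩⟩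
    · exact tanh_mul_le_of_le hρ k₁ (cos_sub_le_cos_half h₁.le (by linarith) (by linarith))
    · exact tanh_mul_le_of_le hρ k₂ (cos_sub_le_cos_half h₂.le (by linarith) (by linarith))
    · exact tanh_mul_le_of_le hρ k₄ (cos_sub_le_cos_half_left h₄.le (by linarith) (by linarith)))
  have i₄ := setLIntegral_radialVolume_sector (Q := causalShadow a₁ b₁ a₂ b₂) h₄ w₄ (by
    rintro χ ⟨hχ, hχ'⟩ ρ hρ
    rw [bulkPoint_mem_causalShadow]
    refine ⟨fun h => h.2.2.2, fun h => ⟨?_, ?_, ?_, h⟩⟩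
    · exact tanh_mul_le_of_le hρ k₁ (cos_sub_le_cos_half h₁.le (by linarith) (by linarith))
    · exact tanh_mul_le_of_le hρ k₂ (cos_sub_le_cos_half h₂.le (by linarith) (by linarith))
    · exact tanh_mul_le_of_le hρ k₃ (cos_sub_le_cos_half h₃.le (by linarith) (by linarith)))
  rw [setLIntegral_Ioc_add_Ioc _ h₁.le (by linarith : b₁ ≤ a₁ + 2 * π),
    setLIntegral_Ioc_add_Ioc _ h₂.le (by linarith : a₂ ≤ a₁ + 2 * π),
    setLIntegral_Ioc_add_Ioc _ h₃.le h₄.le, i₁, i₂, i₃, i₄,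
    ← ENNReal.ofReal_add (by linarith) (by linarith),
    ← ENNReal.ofReal_add (by linarith) (by linarith),
    ← ENNReal.ofReal_add (by linarith) (by linarith)]
  congr 1
  ring

/-- The centre is cut off by the geodesic of the last interval. No ray over that interval meets the
shadow; the other three sectors are strips above the same geodesic, seen as that of `(a₁, b₂)`. -/
theorem lintegral_radialVolume_causalShadow_of_lt {a₁ b₁ a₂ b₂ : ℝ} (h₁ : a₁ < b₁) (h₂ : b₁ < a₂)
    (h₃ : a₂ < b₂) (h₄ : b₂ < a₁ + 2 * π) (w₄ : b₂ + π < a₁ + 2 * π) :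
    ∫⁻ χ in Ioc a₁ (a₁ + 2 * π), radialVolume (causalShadow a₁ b₁ a₂ b₂) χ =
      ENNReal.ofReal (2 * π) := by
  have k₁ := cos_half_nonneg h₁ (by linarith)
  have k₂ := cos_half_nonneg h₂ (by linarith)
  have k₃ := cos_half_nonneg h₃ (by linarith)
  have k₄ : Real.cos ((a₁ + 2 * π - b₂) / 2) < 0 :=
    Real.cos_neg_of_pi_div_two_lt_of_lt (by linarith) (by linarith)
  have hUV : b₂ ≤ a₁ + π := by linarith
  -- The geodesics of complementary intervals coincide; centre and half-width change so that both
  -- cosines flip sign, which reverses the inequality.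
  have e₁ : ∀ χ, Real.cos (χ - (b₂ + (a₁ + 2 * π)) / 2) = -Real.cos (χ - (a₁ + b₂) / 2) := by
    intro χ
    rw [← Real.cos_sub_pi]
    congr 1
    ring
  have e₂ : Real.cos ((a₁ + 2 * π - b₂) / 2) = -Real.cos ((b₂ - a₁) / 2) := by
    rw [← Real.cos_pi_sub]
    congr 1
    ring
  have e₃ : ∀ ρ χ : ℝ, Real.tanh ρ * Real.cos (χ - (b₂ + (a₁ + 2 * π)) / 2) ≤
      Real.cos ((a₁ + 2 * π - b₂) / 2) ↔
      Real.cos ((b₂ - a₁) / 2) ≤ Real.tanh ρ * Real.cos (χ - (a₁ + b₂) / 2) := by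
    intro ρ χ
    rw [e₁, e₂, mul_neg, neg_le_neg_iff]
  obtain ⟨n₁, i₁⟩ := setLIntegral_radialVolume_strip (Q := causalShadow a₁ b₁ a₂ b₂) h₁ le_rfl
    (by linarith) hUV (by
    rintro χ ⟨hχ, hχ'⟩ ρ hρ
    rw [bulkPoint_mem_causalShadow, e₃]
    refine ⟨fun h => ⟨h.1, h.2.2.2⟩, fun h => ⟨h.1, ?_, ?_, h.2⟩⟩
    · exact tanh_mul_le_of_le hρ k₂ (cos_sub_le_cos_half_left h₂.le (by linarith) (by linarith))
    · exact tanh_mul_le_of_le hρ k₃ (cos_sub_le_cos_half_left h₃.le (by linarith) (by linarith)))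
  obtain ⟨n₂, i₂⟩ := setLIntegral_radialVolume_strip (Q := causalShadow a₁ b₁ a₂ b₂) h₂ h₁.le
    h₃.le hUV (by
    rintro χ ⟨hχ, hχ'⟩ ρ hρ
    rw [bulkPoint_mem_causalShadow, e₃]
    refine ⟨fun h => ⟨h.2.1, h.2.2.2⟩, fun h => ⟨?_, h.1, ?_, h.2⟩⟩
    · exact tanh_mul_le_of_le hρ k₁ (cos_sub_le_cos_half h₁.le (by linarith) (by linarith))
    · exact tanh_mul_le_of_le hρ k₃ (cos_sub_le_cos_half_left h₃.le (by linarith) (by linarith)))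
  obtain ⟨n₃, i₃⟩ := setLIntegral_radialVolume_strip (Q := causalShadow a₁ b₁ a₂ b₂) h₃
    (by linarith) le_rfl hUV (by
    rintro χ ⟨hχ, hχ'⟩ ρ hρ
    rw [bulkPoint_mem_causalShadow, e₃]
    refine ⟨fun h => ⟨h.2.2.1, h.2.2.2⟩, fun h => ⟨?_, ?_, h.1, h.2⟩⟩
    · exact tanh_mul_le_of_le hρ k₁ (cos_sub_le_cos_half h₁.le (by linarith) (by linarith))
    · exact tanh_mul_le_of_le hρ k₂ (cos_sub_le_cos_half h₂.le (by linarith) (by linarith)))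
  have i₄ : ∫⁻ χ in Ioc b₂ (a₁ + 2 * π), radialVolume (causalShadow a₁ b₁ a₂ b₂) χ = 0 := by
    rw [lintegral_congr_ae ((ae_restrict_Ioc_mem_Ioo _ _).mono fun χ hχ => ?_), lintegral_zero]
    have hz : ∀ ρ ∈ Ioi (0 : ℝ), ENNReal.ofReal (Real.sinh ρ) *
        (causalShadow a₁ b₁ a₂ b₂).indicator 1 (bulkPoint ρ χ) = 0 := by
      intro ρ hρ
      rw [indicator_of_notMem, mul_zero]
      rw [bulkPoint_mem_causalShadow]
      rintro ⟨-, -, -, h⟩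
      exact absurd h (not_le.2 (lt_tanh_mul_of_neg hρ k₄
        (cos_half_lt_cos_sub (by linarith) hχ.1 hχ.2)))
    rw [radialVolume, setLIntegral_congr_fun measurableSet_Ioi hz, lintegral_zero]
  obtain ⟨hint, hval⟩ := integral_geodesicCosh (by linarith : a₁ < b₂) hUV
  have hsum : (∫ χ in Ioc a₁ b₁, geodesicCosh a₁ b₂ χ) + (∫ χ in Ioc b₁ a₂, geodesicCosh a₁ b₂ χ) +
      (∫ χ in Ioc a₂ b₂, geodesicCosh a₁ b₂ χ) = π := by
    rw [← hval, ← Ioc_union_Ioc_eq_Ioc (by linarith : a₁ ≤ a₂) h₃.le,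
      setIntegral_union (Ioc_disjoint_Ioc_of_le le_rfl) measurableSet_Ioc
        (hint.mono_set (Ioc_subset_Ioc le_rfl h₃.le))
        (hint.mono_set (Ioc_subset_Ioc (by linarith) le_rfl)),
      ← Ioc_union_Ioc_eq_Ioc h₁.le h₂.le,
      setIntegral_union (Ioc_disjoint_Ioc_of_le le_rfl) measurableSet_Ioc
        (hint.mono_set (Ioc_subset_Ioc le_rfl (by linarith)))
        (hint.mono_set (Ioc_subset_Ioc h₁.le h₃.le))]
  rw [setLIntegral_Ioc_add_Ioc _ h₁.le (by linarith : b₁ ≤ a₁ + 2 * π),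
    setLIntegral_Ioc_add_Ioc _ h₂.le (by linarith : a₂ ≤ a₁ + 2 * π),
    setLIntegral_Ioc_add_Ioc _ h₃.le h₄.le, i₁, i₂, i₃, i₄, add_zero,
    ← ENNReal.ofReal_add n₂ n₃, ← ENNReal.ofReal_add n₁ (add_nonneg n₂ n₃)]
  congr 1
  linarith

theorem sliceVolume_causalShadow (L : ℝ) {a₁ b₁ a₂ b₂ : ℝ} (h₁ : a₁ < b₁) (h₂ : b₁ < a₂)
    (h₃ : a₂ < b₂) (h₄ : b₂ < a₁ + 2 * π) :
    sliceVolume L (causalShadow a₁ b₁ a₂ b₂) = ENNReal.ofReal (2 * π * L ^ 2) := by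
  -- The lengths sum to `2π`, so at most one interval exceeds `π`; cyclic relabelling puts it last.
  have hlast : ∀ a₁ b₁ a₂ b₂ : ℝ, a₁ < b₁ → b₁ < a₂ → a₂ < b₂ → b₂ < a₁ + 2 * π →
      b₂ + π < a₁ + 2 * π →
      sliceVolume L (causalShadow a₁ b₁ a₂ b₂) = ENNReal.ofReal (2 * π * L ^ 2) := by
    intro a₁ b₁ a₂ b₂ h₁ h₂ h₃ h₄ w₄
    rw [sliceVolume_eq_lintegral_radialVolume (measurableSet_causalShadow _ _ _ _) L a₁,
      lintegral_radialVolume_causalShadow_of_lt h₁ h₂ h₃ h₄ w₄,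
      ← ENNReal.ofReal_mul (sq_nonneg L), mul_comm]
  rcases le_or_gt b₁ (a₁ + π) with w₁ | w₁
  swap
  · rw [causalShadow_rotate]
    exact hlast _ _ _ _ h₂ h₃ h₄ (by linarith) (by linarith)
  rcases le_or_gt a₂ (b₁ + π) with w₂ | w₂
  swap
  · rw [causalShadow_rotate, causalShadow_rotate]
    exact hlast _ _ _ _ h₃ h₄ (by linarith) (by linarith) (by linarith)
  rcases le_or_gt b₂ (a₂ + π) with w₃ | w₃
  swap
  · rw [causalShadow_rotate, causalShadow_rotate, causalShadow_rotate]
    exact hlast _ _ _ _ h₄ (by linarith) (by linarith) (by linarith) (by linarith)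
  rcases le_or_gt (a₁ + 2 * π) (b₂ + π) with w₄ | w₄
  swap
  · exact hlast _ _ _ _ h₁ h₂ h₃ h₄ w₄
  rw [sliceVolume_eq_lintegral_radialVolume (measurableSet_causalShadow _ _ _ _) L a₁,
    lintegral_radialVolume_causalShadow_of_le h₁ h₂ h₃ h₄ w₁ w₂ w₃ w₄,
    ← ENNReal.ofReal_mul (sq_nonneg L), mul_comm]

/-! ### Chords of the symmetric causal shadow -/

/-- The four geodesics are the sides of the square inscribed in the unit circle with vertices at the
odd multiples of `π/4`. -/
theorem mem_symmetricShadow {z : ℂ} :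
    z ∈ symmetricShadow ↔
      ‖z‖ < 1 ∧ z.re ≤ √2 / 2 ∧ z.im ≤ √2 / 2 ∧ -z.re ≤ √2 / 2 ∧ -z.im ≤ √2 / 2 := by
  have e : ∀ t : ℝ, (z * Complex.exp (-(t : ℂ) * Complex.I)).re =
      z.re * Real.cos t + z.im * Real.sin t := by
    intro t
    rw [← Complex.ofReal_neg, Complex.mul_re, Complex.exp_ofReal_mul_I_re,
      Complex.exp_ofReal_mul_I_im, Real.cos_neg, Real.sin_neg]
    ring
  have d₁ : (π / 4 - -(π / 4)) / 2 = π / 4 := by ring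
  have d₂ : (3 * π / 4 - π / 4) / 2 = π / 4 := by ring
  have d₃ : (5 * π / 4 - 3 * π / 4) / 2 = π / 4 := by ring
  have d₄ : (-(π / 4) + 2 * π - 5 * π / 4) / 2 = π / 4 := by ring
  have c₁ : (-(π / 4) + π / 4) / 2 = 0 := by ring
  have c₂ : (π / 4 + 3 * π / 4) / 2 = π / 2 := by ring
  have c₃ : (3 * π / 4 + 5 * π / 4) / 2 = π := by ring
  have c₄ : (5 * π / 4 + (-(π / 4) + 2 * π)) / 2 = π / 2 + π := by ring
  simp only [symmetricShadow, causalShadow, intervalRegion, mem_ofPred_eq, e, d₁, d₂, d₃, d₄, c₁,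
    c₂, c₃, c₄, Real.cos_pi_div_four, Real.cos_zero, Real.sin_zero, Real.cos_pi_div_two,
    Real.sin_pi_div_two, Real.cos_pi, Real.sin_pi, Real.cos_add_pi, Real.sin_add_pi, not_and, not_lt]
  constructor
  · rintro ⟨h, h1, h2, h3, h4⟩
    refine ⟨h, ?_, ?_, ?_, ?_⟩
    · simpa using h1 h
    · simpa using h2 h
    · simpa using h3 h
    · simpa using h4 h
  · rintro ⟨h, h1, h2, h3, h4⟩
    refine ⟨h, fun _ => ?_, fun _ => ?_, fun _ => ?_, fun _ => ?_⟩
    · simpa using h1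
    · simpa using h2
    · simpa using h3
    · simpa using h4

theorem geodesicPoint_re (u v s : ℝ) :
    (geodesicPoint u v s).re =
      (Real.cos u * (1 - Real.tanh s) + Real.cos v * (1 + Real.tanh s)) / 2 := by
  have h1 : Real.cos u = Real.cos ((u + v) / 2 - (v - u) / 2) := by congr 1; ring
  have h2 : Real.cos v = Real.cos ((u + v) / 2 + (v - u) / 2) := by congr 1; ring
  rw [h1, h2, Real.cos_add, Real.cos_sub, geodesicPoint, Complex.mul_re,
    Complex.exp_ofReal_mul_I_re, Complex.exp_ofReal_mul_I_im]
  simp only [Complex.add_re, Complex.ofReal_re, Complex.mul_re, Complex.I_re, mul_zero,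
    Complex.ofReal_im, Complex.I_im, mul_one, sub_self, add_zero, Complex.add_im, Complex.mul_im,
    zero_add]
  ring

theorem geodesicPoint_im (u v s : ℝ) :
    (geodesicPoint u v s).im =
      (Real.sin u * (1 - Real.tanh s) + Real.sin v * (1 + Real.tanh s)) / 2 := by
  have h1 : Real.sin u = Real.sin ((u + v) / 2 - (v - u) / 2) := by congr 1; ring
  have h2 : Real.sin v = Real.sin ((u + v) / 2 + (v - u) / 2) := by congr 1; ring
  rw [h1, h2, Real.sin_add, Real.sin_sub, geodesicPoint, Complex.mul_im,
    Complex.exp_ofReal_mul_I_re, Complex.exp_ofReal_mul_I_im]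
  simp only [Complex.add_re, Complex.ofReal_re, Complex.mul_re, Complex.I_re, mul_zero,
    Complex.ofReal_im, Complex.I_im, mul_one, sub_self, add_zero, Complex.add_im, Complex.mul_im,
    zero_add]
  ring

theorem norm_geodesicPoint_lt_one {u v : ℝ} (h : Real.sin ((v - u) / 2) ≠ 0) (s : ℝ) :
    ‖geodesicPoint u v s‖ < 1 := by
  rw [geodesicPoint, norm_mul, Complex.norm_exp_ofReal_mul_I, one_mul, Complex.norm_add_mul_I,
    Real.sqrt_lt' one_pos, mul_pow, Real.cos_sq']
  have h1 := Real.tanh_sq_lt_one s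
  have h2 : 0 < Real.sin ((v - u) / 2) ^ 2 := by positivity
  nlinarith

theorem artanh_neg_eq {x : ℝ} (hx : x ∈ Ioo (-1) 1) : artanh (-x) = -artanh x := by
  conv_lhs => rw [← tanh_artanh hx, ← Real.tanh_neg, artanh_tanh]

/-- Arc length is `artanh` of the affine parameter. The negated arguments match the signs in the
closed formulas for the chords. -/
theorem chordLength_of_forall_mem_iff {L : ℝ} (hL : 0 ≤ L) {Q : Set ℂ} {u v A B : ℝ}
    (hA : A ∈ Ioo (-1) 1) (hB : B ∈ Ioo (-1) 1)
    (h : ∀ s, geodesicPoint u v s ∈ Q ↔ A ≤ Real.tanh s ∧ Real.tanh s ≤ B) :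
    chordLength L Q u v = ENNReal.ofReal (L * (artanh (-A) - artanh (-B))) := by
  have : {s : ℝ | geodesicPoint u v s ∈ Q} = Icc (artanh A) (artanh B) := by
    ext s
    rw [mem_ofPred_eq, h, tanh_le_iff hB, le_tanh_iff hA, mem_Icc]
  rw [chordLength, this, Real.volume_Icc, ← ENNReal.ofReal_mul hL, artanh_neg_eq hA,
    artanh_neg_eq hB]
  congr 2
  ring

/-- The angle `χ` given by the arctangent satisfies `cos (θ - χ) = √2 cos α cos χ`, so the radicand
is the square of `√2 cos χ sin α`. Positivity of `cos χ` and `sin α` fixes the root, and `χ` then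
cancels. -/
theorem sin_sub_arctan_div_sqrt {θ α : ℝ} (hθ : 0 < Real.sin θ) (hα : 0 < Real.sin α) :
    Real.sin (θ - arctan ((√2 * Real.cos α - Real.cos θ) / Real.sin θ)) /
        √(2 * Real.cos (arctan ((√2 * Real.cos α - Real.cos θ) / Real.sin θ)) ^ 2 -
          Real.cos (θ - arctan ((√2 * Real.cos α - Real.cos θ) / Real.sin θ)) ^ 2) =
      (√2 - 2 * (Real.cos α * Real.cos θ)) / (2 * (Real.sin α * Real.sin θ)) := by
  set m := (√2 * Real.cos α - Real.cos θ) / Real.sin θ with hm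
  have hc := Real.cos_arctan_pos m
  have hs : Real.sin (arctan m) = m * Real.cos (arctan m) := by
    rw [← Real.tan_mul_cos hc.ne', Real.tan_arctan]
  have hm' : m * Real.sin θ = √2 * Real.cos α - Real.cos θ := by rw [hm]; field_simp
  have h2 : √2 ^ 2 = 2 := Real.sq_sqrt (by norm_num)
  have h20 : 0 < √2 := by positivity
  have hcos : Real.cos (θ - arctan m) = Real.cos (arctan m) * (√2 * Real.cos α) := by
    rw [Real.cos_sub, hs]
    linear_combination Real.cos (arctan m) * hm'
  have hrad : 2 * Real.cos (arctan m) ^ 2 - Real.cos (θ - arctan m) ^ 2 =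
      (√2 * Real.cos (arctan m) * Real.sin α) ^ 2 := by
    rw [hcos]
    have := Real.sin_sq_add_cos_sq α
    linear_combination (-2 * Real.cos (arctan m) ^ 2) * this +
      (-Real.cos (arctan m) ^ 2 * (Real.sin α ^ 2 + Real.cos α ^ 2)) * h2
  rw [hrad, Real.sqrt_sq (by positivity), Real.sin_sub, hs]
  rw [div_eq_div_iff (by positivity) (by positivity)]
  have h1 := Real.sin_sq_add_cos_sq θ
  linear_combination (2 * Real.cos (arctan m) * Real.sin α) * h1 -
    2 * Real.cos (arctan m) * Real.sin α * Real.cos θ * hm' -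
    Real.cos (arctan m) * Real.sin α * h2

theorem cos_sin_bounds {x : ℝ} (h1 : -(π / 4) < x) (h2 : x < π / 4) :
    √2 / 2 < Real.cos x ∧ -(√2 / 2) < Real.sin x ∧ Real.sin x < √2 / 2 := by
  have hp := pi_pos
  refine ⟨?_, ?_, ?_⟩
  · rw [← Real.cos_pi_div_four, ← Real.cos_abs x]
    exact Real.cos_lt_cos_of_nonneg_of_le_pi (abs_nonneg _) (by linarith) (abs_lt.2 ⟨h1, h2⟩)
  · rw [← Real.sin_pi_div_four, ← Real.sin_neg]
    exact Real.sin_lt_sin_of_lt_of_le_pi_div_two (by linarith) (by linarith) h1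
  · rw [← Real.sin_pi_div_four]
    exact Real.sin_lt_sin_of_lt_of_le_pi_div_two (by linarith) (by linarith) h2

theorem cos_sub_cos_eq (u v : ℝ) :
    Real.cos u - Real.cos v = 2 * (Real.sin ((v - u) / 2) * Real.sin ((v + u) / 2)) := by
  have h1 : Real.cos u = Real.cos ((v + u) / 2 - (v - u) / 2) := by congr 1; ring
  have h2 : Real.cos v = Real.cos ((v + u) / 2 + (v - u) / 2) := by congr 1; ring
  rw [h1, h2, Real.cos_add, Real.cos_sub]
  ring

theorem cos_add_cos_eq (u v : ℝ) :
    Real.cos u + Real.cos v = 2 * (Real.cos ((v - u) / 2) * Real.cos ((v + u) / 2)) := by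
  have h1 : Real.cos u = Real.cos ((v + u) / 2 - (v - u) / 2) := by congr 1; ring
  have h2 : Real.cos v = Real.cos ((v + u) / 2 + (v - u) / 2) := by congr 1; ring
  rw [h1, h2, Real.cos_add, Real.cos_sub]
  ring

theorem sin_sub_sin_eq (u v : ℝ) :
    Real.sin v - Real.sin u = 2 * (Real.sin ((v - u) / 2) * Real.cos ((v + u) / 2)) := by
  have h1 : Real.sin u = Real.sin ((v + u) / 2 - (v - u) / 2) := by congr 1; ring
  have h2 : Real.sin v = Real.sin ((v + u) / 2 + (v - u) / 2) := by congr 1; ring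
  rw [h1, h2, Real.sin_add, Real.sin_sub]
  ring

theorem sin_add_sin_eq (u v : ℝ) :
    Real.sin u + Real.sin v = 2 * (Real.cos ((v - u) / 2) * Real.sin ((v + u) / 2)) := by
  have h1 : Real.sin u = Real.sin ((v + u) / 2 - (v - u) / 2) := by congr 1; ring
  have h2 : Real.sin v = Real.sin ((v + u) / 2 + (v - u) / 2) := by congr 1; ring
  rw [h1, h2, Real.sin_add, Real.sin_sub]
  ring

theorem lambdaI_eq (L : ℝ) {u v : ℝ} (hα : 0 < Real.sin ((v - u) / 2))
    (hs : 0 < Real.sin ((v + u) / 2)) (hc : 0 < Real.cos ((v + u) / 2)) :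
    lambdaI L u v = L * (artanh (-((Real.cos u + Real.cos v - √2) / (Real.cos u - Real.cos v))) -
      artanh (-((√2 - Real.sin u - Real.sin v) / (Real.sin v - Real.sin u)))) := by
  have h1 := sin_sub_arctan_div_sqrt hs hα
  have h2 := sin_sub_arctan_div_sqrt (θ := π / 2 - (v + u) / 2)
    (by rwa [Real.sin_pi_div_two_sub]) hα
  rw [Real.sin_pi_div_two_sub, Real.cos_pi_div_two_sub] at h2
  -- The exit angle is the entry angle of the geodesic reflected by `θ ↦ π/2 - θ`, so the same
  -- identity evaluates both terms. For `lambdaII` the reflection is `θ ↦ π - θ`.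
  have e1 : (v + u) / 2 - chiOutI u v = -(π / 2 - (v + u) / 2 -
      arctan ((√2 * Real.cos ((v - u) / 2) - Real.sin ((v + u) / 2)) /
        Real.cos ((v + u) / 2))) := by
    rw [chiOutI]; ring
  unfold lambdaI
  rw [e1, Real.sin_neg, Real.cos_neg, neg_div, chiIn, h1, chiOutI, Real.sin_pi_div_two_sub, h2,
    cos_sub_cos_eq, cos_add_cos_eq, sin_sub_sin_eq, sub_sub, sin_add_sin_eq, ← neg_div, ← neg_div, neg_sub,
    neg_sub]

theorem lambdaII_eq (L : ℝ) {u v : ℝ} (hα : 0 < Real.sin ((v - u) / 2))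
    (hs : 0 < Real.sin ((v + u) / 2)) :
    lambdaII L u v = L * (artanh (-((Real.cos u + Real.cos v - √2) / (Real.cos u - Real.cos v))) -
      artanh (-((√2 + (Real.cos u + Real.cos v)) / (Real.cos u - Real.cos v)))) := by
  have h1 := sin_sub_arctan_div_sqrt hs hα
  have h2 := sin_sub_arctan_div_sqrt (θ := π - (v + u) / 2) (by rwa [Real.sin_pi_sub]) hα
  rw [Real.sin_pi_sub, Real.cos_pi_sub, sub_neg_eq_add] at h2
  have e1 : (v + u) / 2 - chiOutII u v = -(π - (v + u) / 2 -
      arctan ((√2 * Real.cos ((v - u) / 2) + Real.cos ((v + u) / 2)) /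
        Real.sin ((v + u) / 2))) := by
    rw [chiOutII, arctan_neg]; ring
  have e2 : Real.cos (chiOutII u v) ^ 2 =
      Real.cos (arctan ((√2 * Real.cos ((v - u) / 2) + Real.cos ((v + u) / 2)) /
        Real.sin ((v + u) / 2))) ^ 2 := by
    rw [chiOutII, arctan_neg, ← sub_eq_add_neg, Real.cos_pi_sub, neg_sq]
  unfold lambdaII
  rw [e1, e2, Real.sin_neg, Real.cos_neg, neg_div, chiIn, h1, h2,
    cos_sub_cos_eq, cos_add_cos_eq, ← neg_div _ (2 * (Real.cos _ * Real.cos _) - √2), neg_sub,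
    mul_neg, mul_neg, sub_neg_eq_add]

theorem sq_re_add_sq_im_le_one (u v : ℝ) {T : ℝ} (h1 : -1 ≤ T) (h2 : T ≤ 1) :
    ((Real.cos u * (1 - T) + Real.cos v * (1 + T)) / 2) ^ 2 +
      ((Real.sin u * (1 - T) + Real.sin v * (1 + T)) / 2) ^ 2 ≤ 1 := by
  have hc := Real.cos_le_one (u - v)
  rw [Real.cos_sub] at hc
  have hu := Real.sin_sq_add_cos_sq u
  have hv := Real.sin_sq_add_cos_sq v
  have hT : 0 ≤ (1 - T) * (1 + T) := mul_nonneg (by linarith) (by linarith)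
  nlinarith [mul_le_mul_of_nonneg_left hc hT]

theorem chordLength_symmetricShadow_I {L : ℝ} (hL : 0 < L) {u v : ℝ} (hu : u ∈ Ioo (-(π / 4)) (π / 4))
    (hv : v ∈ Ioo (π / 4) (3 * π / 4)) :
    0 ≤ lambdaI L u v ∧
      chordLength L symmetricShadow u v = ENNReal.ofReal (lambdaI L u v) := by
  obtain ⟨hu1, hu2⟩ := hu
  obtain ⟨hv1, hv2⟩ := hv
  have hp := pi_pos
  have hα : 0 < Real.sin ((v - u) / 2) :=
    Real.sin_pos_of_pos_of_lt_pi (by linarith) (by linarith)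
  have hs : 0 < Real.sin ((v + u) / 2) :=
    Real.sin_pos_of_pos_of_lt_pi (by linarith) (by linarith)
  have hc : 0 < Real.cos ((v + u) / 2) := Real.cos_pos_of_mem_Ioo ⟨by linarith, by linarith⟩
  obtain ⟨p1, p2, p3⟩ := cos_sin_bounds hu1 hu2
  obtain ⟨q1, q2, q3⟩ := cos_sin_bounds (x := v - π / 2) (by linarith) (by linarith)
  rw [Real.cos_sub_pi_div_two] at q1
  rw [Real.sin_sub_pi_div_two] at q2 q3
  have h2 : √2 ^ 2 = 2 := Real.sq_sqrt (by norm_num)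
  have h20 : 0 < √2 := by positivity
  set A := (Real.cos u + Real.cos v - √2) / (Real.cos u - Real.cos v) with hA
  set B := (√2 - Real.sin u - Real.sin v) / (Real.sin v - Real.sin u) with hB
  have dA : 0 < Real.cos u - Real.cos v := by linarith
  have dB : 0 < Real.sin v - Real.sin u := by linarith
  have hAm : A ∈ Ioo (-1 : ℝ) 1 :=
    ⟨by rw [hA, lt_div_iff₀ dA]; linarith, by rw [hA, div_lt_one dA]; linarith⟩
  have hBm : B ∈ Ioo (-1 : ℝ) 1 :=
    ⟨by rw [hB, lt_div_iff₀ dB]; linarith, by rw [hB, div_lt_one dB]; linarith⟩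
  have iA : ∀ T : ℝ, (Real.cos u * (1 - T) + Real.cos v * (1 + T)) / 2 ≤ √2 / 2 ↔ A ≤ T := by
    intro T
    rw [hA, div_le_iff₀ dA]
    constructor <;> intro h <;> linarith
  have iB : ∀ T : ℝ, (Real.sin u * (1 - T) + Real.sin v * (1 + T)) / 2 ≤ √2 / 2 ↔ T ≤ B := by
    intro T
    rw [hB, le_div_iff₀ dB]
    constructor <;> intro h <;> linarith
  -- The crossing with the side `re = √2/2` lies in the closed unit disc, so its imaginary part is
  -- at most `√2/2`: the crossing at `A` comes no later than that at `B`.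
  have hAB : A ≤ B := by
    rw [← iB]
    have hx : (Real.cos u * (1 - A) + Real.cos v * (1 + A)) / 2 = √2 / 2 := by
      rw [hA]; field_simp; ring
    have := sq_re_add_sq_im_le_one u v hAm.1.le hAm.2.le
    rw [hx] at this
    have h3 : (√2 / 2) ^ 2 = 1 / 2 := by rw [div_pow, h2]; norm_num
    exact (abs_le_of_sq_le_sq' (by linarith) (by positivity)).2
  have hmem : ∀ s, geodesicPoint u v s ∈ symmetricShadow ↔ A ≤ Real.tanh s ∧ Real.tanh s ≤ B := by
    intro s
    have t1 := Real.neg_one_lt_tanh s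
    have t2 := Real.tanh_lt_one s
    rw [mem_symmetricShadow, geodesicPoint_re, geodesicPoint_im, iA, iB]
    -- The other two sides are never crossed: both endpoints lie strictly on their inner side.
    refine ⟨fun h => ⟨h.2.1, h.2.2.1⟩,
      fun h => ⟨norm_geodesicPoint_lt_one hα.ne' s, h.1, h.2, ?_, ?_⟩⟩ <;> nlinarith
  rw [lambdaI_eq L hα hs hc]
  refine ⟨?_, chordLength_of_forall_mem_iff hL.le hAm hBm hmem⟩
  rw [artanh_neg_eq hAm, artanh_neg_eq hBm]
  have := artanh_le_artanh hAm.1 hBm.2 hAB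
  exact mul_nonneg hL.le (by linarith)

theorem chordLength_symmetricShadow_II {L : ℝ} (hL : 0 < L) {u v : ℝ} (hu : u ∈ Ioo (-(π / 4)) (π / 4))
    (hv : v ∈ Ioo (3 * π / 4) (5 * π / 4)) :
    0 ≤ lambdaII L u v ∧
      chordLength L symmetricShadow u v = ENNReal.ofReal (lambdaII L u v) := by
  obtain ⟨hu1, hu2⟩ := hu
  obtain ⟨hv1, hv2⟩ := hv
  have hp := pi_pos
  have hα : 0 < Real.sin ((v - u) / 2) :=
    Real.sin_pos_of_pos_of_lt_pi (by linarith) (by linarith)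
  have hs : 0 < Real.sin ((v + u) / 2) :=
    Real.sin_pos_of_pos_of_lt_pi (by linarith) (by linarith)
  obtain ⟨p1, p2, p3⟩ := cos_sin_bounds hu1 hu2
  obtain ⟨q1, q2, q3⟩ := cos_sin_bounds (x := v - π) (by linarith) (by linarith)
  rw [Real.cos_sub_pi] at q1
  rw [Real.sin_sub_pi] at q2 q3
  have h20 : 0 < √2 := by positivity
  set A := (Real.cos u + Real.cos v - √2) / (Real.cos u - Real.cos v) with hA
  set B := (√2 + (Real.cos u + Real.cos v)) / (Real.cos u - Real.cos v) with hB
  have dA : 0 < Real.cos u - Real.cos v := by linarith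
  have hAm : A ∈ Ioo (-1 : ℝ) 1 :=
    ⟨by rw [hA, lt_div_iff₀ dA]; linarith, by rw [hA, div_lt_one dA]; linarith⟩
  have hBm : B ∈ Ioo (-1 : ℝ) 1 :=
    ⟨by rw [hB, lt_div_iff₀ dA]; linarith, by rw [hB, div_lt_one dA]; linarith⟩
  have iA : ∀ T : ℝ, (Real.cos u * (1 - T) + Real.cos v * (1 + T)) / 2 ≤ √2 / 2 ↔ A ≤ T := by
    intro T
    rw [hA, div_le_iff₀ dA]
    constructor <;> intro h <;> linarith
  have iB : ∀ T : ℝ, -((Real.cos u * (1 - T) + Real.cos v * (1 + T)) / 2) ≤ √2 / 2 ↔ T ≤ B := by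
    intro T
    rw [hB, le_div_iff₀ dA]
    constructor <;> intro h <;> linarith
  have hAB : A ≤ B := div_le_div_of_nonneg_right (by linarith) dA.le
  have hmem : ∀ s, geodesicPoint u v s ∈ symmetricShadow ↔ A ≤ Real.tanh s ∧ Real.tanh s ≤ B := by
    intro s
    have t1 := Real.neg_one_lt_tanh s
    have t2 := Real.tanh_lt_one s
    rw [mem_symmetricShadow, geodesicPoint_re, geodesicPoint_im, iA, iB]
    refine ⟨fun h => ⟨h.2.1, h.2.2.2.1⟩,
      fun h => ⟨norm_geodesicPoint_lt_one hα.ne' s, h.1, ?_, h.2, ?_⟩⟩ <;> nlinarith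
  rw [lambdaII_eq L hα hs]
  refine ⟨?_, chordLength_of_forall_mem_iff hL.le hAm hBm hmem⟩
  rw [artanh_neg_eq hAm, artanh_neg_eq hBm]
  have := artanh_le_artanh hAm.1 hBm.2 hAB
  exact mul_nonneg hL.le (by linarith)

/-! ### The kinematic space integral of the symmetric causal shadow -/

theorem mem_symmetricShadow_I_mul {z : ℂ} :
    Complex.I * z ∈ symmetricShadow ↔ z ∈ symmetricShadow := by
  rw [mem_symmetricShadow, mem_symmetricShadow, norm_mul, Complex.norm_I, one_mul, Complex.I_mul_re,
    Complex.I_mul_im, neg_neg]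
  tauto

theorem mem_symmetricShadow_conj {z : ℂ} :
    (starRingEnd ℂ) z ∈ symmetricShadow ↔ z ∈ symmetricShadow := by
  rw [mem_symmetricShadow, mem_symmetricShadow, Complex.norm_conj, Complex.conj_re, Complex.conj_im,
    neg_neg]
  tauto

theorem geodesicPoint_add_pi_div_two (u v s : ℝ) :
    geodesicPoint (u + π / 2) (v + π / 2) s = Complex.I * geodesicPoint u v s := by
  apply Complex.ext
  · rw [Complex.I_mul_re, geodesicPoint_re, geodesicPoint_im, Real.cos_add_pi_div_two,
      Real.cos_add_pi_div_two]
    ring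
  · rw [Complex.I_mul_im, geodesicPoint_re, geodesicPoint_im, Real.sin_add_pi_div_two,
      Real.sin_add_pi_div_two]

theorem geodesicPoint_neg (u v s : ℝ) :
    geodesicPoint (-u) (2 * π - v) s = (starRingEnd ℂ) (geodesicPoint u v s) := by
  apply Complex.ext
  · rw [Complex.conj_re, geodesicPoint_re, geodesicPoint_re, Real.cos_neg, Real.cos_two_pi_sub]
  · rw [Complex.conj_im, geodesicPoint_im, geodesicPoint_im, Real.sin_neg, Real.sin_two_pi_sub]
    ring

theorem chordLength_symmetricShadow_add_pi_div_two (L u v : ℝ) :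
    chordLength L symmetricShadow (u + π / 2) (v + π / 2) = chordLength L symmetricShadow u v := by
  simp only [chordLength, geodesicPoint_add_pi_div_two, mem_symmetricShadow_I_mul]

theorem chordLength_symmetricShadow_neg (L u v : ℝ) :
    chordLength L symmetricShadow (-u) (2 * π - v) = chordLength L symmetricShadow u v := by
  simp only [chordLength, geodesicPoint_neg, mem_symmetricShadow_conj]

theorem croftonDensity_neg (L G u v : ℝ) :
    croftonDensity L G (-u) (2 * π - v) = croftonDensity L G u v := by
  have : (2 * π - v - -u) / 2 = π - (v - u) / 2 := by ring
  rw [croftonDensity, this, Real.sin_pi_sub, croftonDensity]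

/-- Both ends lie beyond the line `re = √2/2`, hence so does the whole segment. -/
theorem chordLength_symmetricShadow_eq_zero (L : ℝ) {u v : ℝ} (hu : √2 / 2 < Real.cos u)
    (hv : √2 / 2 < Real.cos v) : chordLength L symmetricShadow u v = 0 := by
  have : ∀ s, geodesicPoint u v s ∉ symmetricShadow := by
    intro s
    rw [mem_symmetricShadow, geodesicPoint_re]
    rintro ⟨-, h, -⟩
    have t1 := Real.neg_one_lt_tanh s
    have t2 := Real.tanh_lt_one s
    nlinarith
  simp [chordLength, this]

theorem setLIntegral_Ioc_comp_sub_left (g : ℝ → ℝ≥0∞) (a b c : ℝ) :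
    ∫⁻ x in Ioc a b, g (c - x) = ∫⁻ x in Ioc (c - b) (c - a), g x := by
  have h := (Measure.measurePreserving_sub_left volume c).setLIntegral_comp_preimage_emb
    (MeasurableEquiv.subLeft c).measurableEmbedding g (Ico (c - b) (c - a))
  have hp : (fun x => c - x) ⁻¹' Ico (c - b) (c - a) = Ioc a b := by
    ext x
    simp only [mem_preimage, mem_Ico, mem_Ioc]
    constructor <;> rintro ⟨_, _⟩ <;> constructor <;> linarith
  rw [hp] at h
  rw [h, setLIntegral_congr Ico_ae_eq_Ioc]

theorem restrict_Icc_prod_Icc (a b c d : ℝ) :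
    (volume : Measure (ℝ × ℝ)).restrict (Icc a b ×ˢ Icc c d) =
      (volume.restrict (Ioc a b)).prod (volume.restrict (Ioc c d)) := by
  rw [Measure.volume_eq_prod, ← Measure.prod_restrict, restrict_Ioc_eq_restrict_Icc,
    restrict_Ioc_eq_restrict_Icc]

theorem ae_mem_Ioo_prod_Ioo (a b c d : ℝ) :
    ∀ᵐ p : ℝ × ℝ ∂volume.restrict (Icc a b ×ˢ Icc c d), p.1 ∈ Ioo a b ∧ p.2 ∈ Ioo c d := by
  rw [Measure.volume_eq_prod, ← Measure.prod_restrict, ← restrict_Ioo_eq_restrict_Icc,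
    ← restrict_Ioo_eq_restrict_Icc, Measure.prod_restrict]
  exact ae_restrict_mem (measurableSet_Ioo.prod measurableSet_Ioo)

/-- A function on kinematic space with the symmetries of the square, vanishing on geodesics with
both ends in `A₁`, integrates to `4 (2 I + II)`. -/
theorem setLIntegral_geodesicStrip_of_symmetric {f : ℝ → ℝ → ℝ≥0∞}
    (hfm : Measurable (Function.uncurry f)) (hrot : ∀ u v, f (u + π / 2) (v + π / 2) = f u v)
    (hneg : ∀ u v, f (-u) (2 * π - v) = f u v)
    (hzero : ∀ u v, √2 / 2 < Real.cos u → √2 / 2 < Real.cos v → f u v = 0) :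
    ∫⁻ p in geodesicStrip, f p.1 p.2 =
      4 * (2 * (∫⁻ p in squareI, f p.1 p.2) + ∫⁻ p in squareII, f p.1 p.2) := by
  have hp := pi_pos
  have hper : ∀ u v, f (u + 2 * π) (v + 2 * π) = f u v := fun u v => by
    rw [show ∀ x : ℝ, x + 2 * π = x + π / 2 + π / 2 + π / 2 + π / 2 by intro x; ring,
      show ∀ x : ℝ, x + 2 * π = x + π / 2 + π / 2 + π / 2 + π / 2 by intro x; ring,
      hrot, hrot, hrot, hrot]
  rw [setLIntegral_geodesicStrip hfm hper (-(π / 4))]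
  -- At fixed `d` the integrand has period `π/2` in `u`, so it suffices to let the first endpoint
  -- run over `A₁`.
  have hfour : ∀ d, ∫⁻ u in Ioc (-(π / 4)) (-(π / 4) + 2 * π), f u (u + d) =
      4 * ∫⁻ u in Ioc (-(π / 4)) (π / 4), f u (u + d) := by
    intro d
    have hper : Function.Periodic (fun u => f u (u + d)) (π / 2) := fun u => by
      simp only [add_right_comm u (π / 2) d, hrot]
    have hq := fun a => setLIntegral_Ioc_eq_of_periodic (by positivity) hper a (-(π / 4))
    -- This rewrite also hits the `π / 4` inside `-(π / 4)`; the next one restores it.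
    rw [show π / 4 = -(π / 4) + π / 2 by ring]
    rw [show -(-(π / 4) + π / 2) = -(π / 4) by ring,
      setLIntegral_Ioc_add_Ioc (b := -(π / 4) + π / 2) _ (by linarith) (by linarith),
      setLIntegral_Ioc_add_Ioc (a := -(π / 4) + π / 2) (b := -(π / 4) + π / 2 + π / 2) _
        (by linarith) (by linarith),
      setLIntegral_Ioc_add_Ioc (a := -(π / 4) + π / 2 + π / 2)
        (b := -(π / 4) + π / 2 + π / 2 + π / 2) _ (by linarith) (by linarith),
      show -(π / 4) + 2 * π = -(π / 4) + π / 2 + π / 2 + π / 2 + π / 2 by ring,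
      hq (-(π / 4) + π / 2), hq (-(π / 4) + π / 2 + π / 2),
      hq (-(π / 4) + π / 2 + π / 2 + π / 2)]
    ring
  simp_rw [hfour]
  have hm2 : Measurable fun p : ℝ × ℝ => f p.2 (p.2 + p.1) :=
    hfm.comp (by fun_prop : Measurable fun p : ℝ × ℝ => (p.2, p.2 + p.1))
  rw [lintegral_const_mul' _ _ (by norm_num), lintegral_lintegral_swap hm2.aemeasurable]
  congr 1
  have hshift : ∀ u, ∫⁻ d in Ioo 0 (2 * π), f u (u + d) = ∫⁻ v in Ioc u (u + 2 * π), f u v := by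
    intro u
    rw [setLIntegral_congr Ioo_ae_eq_Ioc]
    have h := (measurePreserving_add_left volume u).setLIntegral_comp_preimage_emb
      (measurableEmbedding_addLeft u) (f u) (Ioc u (u + 2 * π))
    have hpre : (fun x => u + x) ⁻¹' Ioc u (u + 2 * π) = Ioc 0 (2 * π) := by
      ext x
      simp only [mem_preimage, mem_Ioc]
      constructor <;> rintro ⟨_, _⟩ <;> constructor <;> linarith
    rw [← h, hpre]
  -- The second endpoint runs once around the circle. Its two pieces inside `A₁` contribute nothing,
  -- leaving the adjacent arc, the opposite arc, and the other adjacent arc, which complex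
  -- conjugation maps to the first.
  have hinner : ∀ u ∈ Ioo (-(π / 4)) (π / 4), ∫⁻ d in Ioo 0 (2 * π), f u (u + d) =
      (∫⁻ v in Ioc (π / 4) (3 * π / 4), f u v) + (∫⁻ v in Ioc (3 * π / 4) (5 * π / 4), f u v) +
        ∫⁻ v in Ioc (5 * π / 4) (7 * π / 4), f u v := by
    rintro u ⟨hu1, hu2⟩
    have hcu := (cos_sin_bounds hu1 hu2).1
    have hfirst : ∫⁻ v in Ioc u (π / 4), f u v = 0 := by
      rw [lintegral_congr_ae ((ae_restrict_Ioc_mem_Ioo _ _).mono fun v hv => ?_), lintegral_zero]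
      have hcv := (cos_sin_bounds (hu1.trans hv.1) hv.2).1
      exact hzero u v hcu hcv
    have hlast : ∫⁻ v in Ioc (7 * π / 4) (u + 2 * π), f u v = 0 := by
      rw [lintegral_congr_ae ((ae_restrict_Ioc_mem_Ioo _ _).mono fun v hv => ?_), lintegral_zero]
      have hcv := (cos_sin_bounds (x := v - 2 * π) (by linarith [hv.1]) (by linarith [hv.2])).1
      rw [Real.cos_sub_two_pi] at hcv
      exact hzero u v hcu hcv
    rw [hshift, setLIntegral_Ioc_add_Ioc (b := π / 4) _ hu2.le (by linarith),
      setLIntegral_Ioc_add_Ioc (a := π / 4) (b := 3 * π / 4) _ (by linarith) (by linarith),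
      setLIntegral_Ioc_add_Ioc (a := 3 * π / 4) (b := 5 * π / 4) _ (by linarith) (by linarith),
      setLIntegral_Ioc_add_Ioc (a := 5 * π / 4) (b := 7 * π / 4) _ (by linarith) (by linarith),
      hfirst, hlast, zero_add, add_zero, add_assoc]
  have hrefl : ∀ u, ∫⁻ v in Ioc (5 * π / 4) (7 * π / 4), f u v =
      ∫⁻ v in Ioc (π / 4) (3 * π / 4), f (0 - u) v := by
    intro u
    have h := setLIntegral_Ioc_comp_sub_left (f (0 - u)) (5 * π / 4) (7 * π / 4) (2 * π)
    rw [show 2 * π - 7 * π / 4 = π / 4 by ring, show 2 * π - 5 * π / 4 = 3 * π / 4 by ring] at h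
    rw [← h]
    refine lintegral_congr fun v => ?_
    rw [zero_sub, hneg]
  have hIm : Measurable fun u => ∫⁻ v in Ioc (π / 4) (3 * π / 4), f u v :=
    hfm.lintegral_prod_right
  have hIIm : Measurable fun u => ∫⁻ v in Ioc (3 * π / 4) (5 * π / 4), f u v :=
    hfm.lintegral_prod_right
  have hthird : ∫⁻ u in Ioc (-(π / 4)) (π / 4), ∫⁻ v in Ioc (5 * π / 4) (7 * π / 4), f u v =
      ∫⁻ u in Ioc (-(π / 4)) (π / 4), ∫⁻ v in Ioc (π / 4) (3 * π / 4), f u v := by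
    simp_rw [hrefl]
    rw [setLIntegral_Ioc_comp_sub_left (fun u => ∫⁻ v in Ioc (π / 4) (3 * π / 4), f u v),
      zero_sub, zero_sub, neg_neg]
  have hsqI : ∫⁻ p in squareI, f p.1 p.2 =
      ∫⁻ u in Ioc (-(π / 4)) (π / 4), ∫⁻ v in Ioc (π / 4) (3 * π / 4), f u v := by
    rw [squareI, restrict_Icc_prod_Icc]
    exact lintegral_prod _ hfm.aemeasurable
  have hsqII : ∫⁻ p in squareII, f p.1 p.2 =
      ∫⁻ u in Ioc (-(π / 4)) (π / 4), ∫⁻ v in Ioc (3 * π / 4) (5 * π / 4), f u v := by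
    rw [squareII, restrict_Icc_prod_Icc]
    exact lintegral_prod _ hfm.aemeasurable
  rw [lintegral_congr_ae ((ae_restrict_Ioc_mem_Ioo _ _).mono hinner),
    lintegral_add_left (hIm.fun_add hIIm), lintegral_add_left hIm, hthird, ← hsqI, ← hsqII]
  ring

theorem setLIntegral_geodesicStrip_symmetricShadow (L G : ℝ) :
    ∫⁻ p in geodesicStrip, chordLength L symmetricShadow p.1 p.2 *
        ENNReal.ofReal (croftonDensity L G p.1 p.2) =
      4 * (2 * (∫⁻ p in squareI, chordLength L symmetricShadow p.1 p.2 *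
          ENNReal.ofReal (croftonDensity L G p.1 p.2)) +
        ∫⁻ p in squareII, chordLength L symmetricShadow p.1 p.2 *
          ENNReal.ofReal (croftonDensity L G p.1 p.2)) := by
  have hQ : MeasurableSet symmetricShadow := measurableSet_causalShadow _ _ _ _
  have hdm : Measurable fun p : ℝ × ℝ => croftonDensity L G p.1 p.2 := by
    unfold croftonDensity; fun_prop
  refine setLIntegral_geodesicStrip_of_symmetric
    (f := fun u v => chordLength L symmetricShadow u v * ENNReal.ofReal (croftonDensity L G u v))
    ((measurable_chordLength L hQ).mul hdm.ennreal_ofReal) (fun u v => ?_) (fun u v => ?_)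
    fun u v hu hv => ?_
  · simp only [chordLength_symmetricShadow_add_pi_div_two, croftonDensity, add_sub_add_right_eq_sub]
  · simp only [chordLength_symmetricShadow_neg, croftonDensity_neg]
  · simp only [chordLength_symmetricShadow_eq_zero L hu hv, zero_mul]

/-- The almost everywhere measurability of `h` is inherited from `f`, so the explicit chord
functions need no measurability proof. -/
theorem integrableOn_and_ofReal_integral_eq {α : Type*} [MeasurableSpace α] {μ : Measure α}
    {s : Set α} {h : α → ℝ} {f : α → ℝ≥0∞} (hf : Measurable f) (hfin : ∫⁻ p in s, f p ∂μ ≠ ∞)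
    (hae : ∀ᵐ p ∂μ.restrict s, 0 ≤ h p ∧ f p = ENNReal.ofReal (h p)) :
    IntegrableOn h s μ ∧ ∫ p in s, h p ∂μ = (∫⁻ p in s, f p ∂μ).toReal := by
  have heq : (fun p => (f p).toReal) =ᵐ[μ.restrict s] h :=
    hae.mono fun p hp => by simp only [hp.2, ENNReal.toReal_ofReal hp.1]
  constructor
  · exact (integrable_toReal_of_lintegral_ne_top hf.aemeasurable hfin).congr heq
  · rw [← integral_congr_ae heq, integral_toReal hf.aemeasurable]
    exact hae.mono fun p hp => by rw [hp.2]; exact ENNReal.ofReal_lt_top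

theorem symmetric_integral_identity {L G ε : ℝ} (hL : 0 < L) (hG : 0 < G) (hε : 0 < ε) :
    IntegrableOn (fun p : ℝ × ℝ => lambdaI L p.1 p.2 * crofton L G ε p.1 p.2) squareI ∧
      IntegrableOn (fun p : ℝ × ℝ => lambdaII L p.1 p.2 * crofton L G ε p.1 p.2) squareII ∧
      2 * π * L ^ 2 = 8 * G / π *
        (2 * (∫ p in squareI, lambdaI L p.1 p.2 * crofton L G ε p.1 p.2) +
          ∫ p in squareII, lambdaII L p.1 p.2 * crofton L G ε p.1 p.2) := by
  have hp := pi_pos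
  have hQ : MeasurableSet symmetricShadow := measurableSet_causalShadow _ _ _ _
  have hdm : Measurable fun p : ℝ × ℝ => croftonDensity L G p.1 p.2 := by
    unfold croftonDensity; fun_prop
  have hfm : Measurable fun p : ℝ × ℝ => chordLength L symmetricShadow p.1 p.2 *
      ENNReal.ofReal (croftonDensity L G p.1 p.2) :=
    (measurable_chordLength L hQ).mul hdm.ennreal_ofReal
  have key := setLIntegral_geodesicStrip_symmetricShadow L G
  rw [setLIntegral_geodesicStrip_croftonDensity hQ hL hG] at key
  have hvol : sliceVolume L symmetricShadow = ENNReal.ofReal (2 * π * L ^ 2) :=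
    sliceVolume_causalShadow L (by linarith) (by linarith) (by linarith) (by linarith)
  rw [hvol, ← ENNReal.ofReal_mul (by positivity)] at key
  set X := ∫⁻ p in squareI, chordLength L symmetricShadow p.1 p.2 *
    ENNReal.ofReal (croftonDensity L G p.1 p.2)
  set Y := ∫⁻ p in squareII, chordLength L symmetricShadow p.1 p.2 *
    ENNReal.ofReal (croftonDensity L G p.1 p.2)
  -- The known finite total bounds each square's share, which is what makes the real integrals
  -- converge.
  have hXY : 4 * (2 * X + Y) ≠ ∞ := key ▸ ENNReal.ofReal_ne_top
  have hX : X ≠ ∞ := by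
    rintro h
    rw [h] at hXY
    simp [ENNReal.mul_top] at hXY
  have hY : Y ≠ ∞ := by
    rintro h
    rw [h] at hXY
    simp [ENNReal.mul_top] at hXY
  have hden : ∀ u v, u < v → v < u + 2 * π → croftonDensity L G u v = crofton L G ε u v :=
    fun u v h h' => (crofton_eq L G ε hε (sin_half_sub_pos h h').ne').symm
  have hI := integrableOn_and_ofReal_integral_eq
    (h := fun p : ℝ × ℝ => lambdaI L p.1 p.2 * crofton L G ε p.1 p.2) hfm hX
    ((ae_mem_Ioo_prod_Ioo _ _ _ _).mono fun p hp' => by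
      obtain ⟨hu, hv⟩ := hp'
      obtain ⟨h1, h2⟩ := chordLength_symmetricShadow_I hL hu hv
      have h3 : p.1 < p.2 := hu.2.trans hv.1
      have h4 : p.2 < p.1 + 2 * π := by linarith [hu.1, hv.2]
      refine ⟨mul_nonneg h1 (crofton_nonneg hL hG hε h3 h4), ?_⟩
      rw [h2, hden _ _ h3 h4, ENNReal.ofReal_mul h1])
  have hII := integrableOn_and_ofReal_integral_eq
    (h := fun p : ℝ × ℝ => lambdaII L p.1 p.2 * crofton L G ε p.1 p.2) hfm hY
    ((ae_mem_Ioo_prod_Ioo _ _ _ _).mono fun p hp' => by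
      obtain ⟨hu, hv⟩ := hp'
      obtain ⟨h1, h2⟩ := chordLength_symmetricShadow_II hL hu hv
      have h3 : p.1 < p.2 := by linarith [hu.2, hv.1]
      have h4 : p.2 < p.1 + 2 * π := by linarith [hu.1, hv.2]
      refine ⟨mul_nonneg h1 (crofton_nonneg hL hG hε h3 h4), ?_⟩
      rw [h2, hden _ _ h3 h4, ENNReal.ofReal_mul h1])
  refine ⟨hI.1, hII.1, ?_⟩
  rw [hI.2, hII.2]
  have hreal := congrArg ENNReal.toReal key
  rw [ENNReal.toReal_ofReal (by positivity), ENNReal.toReal_mul,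
    ENNReal.toReal_add (ENNReal.mul_ne_top (by norm_num) hX) hY, ENNReal.toReal_mul] at hreal
  simp only [ENNReal.toReal_ofNat] at hreal
  change 2 * π * L ^ 2 = 8 * G / π * (2 * X.toReal + Y.toReal)
  rw [show 8 * G / π * (2 * X.toReal + Y.toReal) =
    2 * G / π * (4 * (2 * X.toReal + Y.toReal)) by ring, ← hreal]
  field_simp

/-! ### The theorem -/

theorem mainTheorem2 (L G ε : ℝ) (hL : 0 < L) (hG : 0 < G) (hε : 0 < ε) :
    -- the integral identity at the symmetric phase transition
    (IntegrableOn (fun p : ℝ × ℝ => lambdaI L p.1 p.2 * crofton L G ε p.1 p.2) squareI ∧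
      IntegrableOn (fun p : ℝ × ℝ => lambdaII L p.1 p.2 * crofton L G ε p.1 p.2) squareII ∧
      2 * π * L ^ 2 = 8 * G / π *
        (2 * (∫ p in squareI, lambdaI L p.1 p.2 * crofton L G ε p.1 p.2) +
          ∫ p in squareII, lambdaII L p.1 p.2 * crofton L G ε p.1 p.2)) ∧
    -- the Crofton density in light-cone coordinates
    (∀ u v : ℝ, u < v → v < u + 2 * π →
      crofton L G ε u v = L / (4 * G) * (1 / (2 * Real.sin ((v - u) / 2) ^ 2))) ∧
    -- the functions being integrated are the chords of the causal shadow
    (∀ u v : ℝ, (u, v) ∈ interior squareI →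
      chordLength L symmetricShadow u v = ENNReal.ofReal (lambdaI L u v)) ∧
    (∀ u v : ℝ, (u, v) ∈ interior squareII →
      chordLength L symmetricShadow u v = ENNReal.ofReal (lambdaII L u v)) ∧
    -- the kinematic space integral is the volume of the causal shadow, whatever the placement
    (∀ a₁ b₁ a₂ b₂ : ℝ, a₁ < b₁ → b₁ < a₂ → a₂ < b₂ → b₂ < a₁ + 2 * π →
      sliceVolume L (causalShadow a₁ b₁ a₂ b₂) = ENNReal.ofReal (2 * π * L ^ 2) ∧
      ENNReal.ofReal (2 * G / π) *
          (∫⁻ p in kinematicRegion (causalShadow a₁ b₁ a₂ b₂),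
            chordLength L (causalShadow a₁ b₁ a₂ b₂) p.1 p.2 *
              ENNReal.ofReal (crofton L G ε p.1 p.2)) =
        ENNReal.ofReal (2 * π * L ^ 2)) := by
  refine ⟨symmetric_integral_identity hL hG hε, ?_, ?_, ?_, ?_⟩
  · intro u v h h'
    exact crofton_eq L G ε hε (sin_half_sub_pos h h').ne'
  · intro u v h
    rw [squareI, interior_prod_eq, interior_Icc, interior_Icc] at h
    exact (chordLength_symmetricShadow_I hL h.1 h.2).2
  · intro u v h
    rw [squareII, interior_prod_eq, interior_Icc, interior_Icc] at h
    exact (chordLength_symmetricShadow_II hL h.1 h.2).2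
  · intro a₁ b₁ a₂ b₂ h₁ h₂ h₃ h₄
    refine ⟨sliceVolume_causalShadow L h₁ h₂ h₃ h₄, ?_⟩
    rw [setLIntegral_kinematicRegion (measurableSet_causalShadow _ _ _ _) hL hG hε,
      sliceVolume_causalShadow L h₁ h₂ h₃ h₄, ← mul_assoc, ← ENNReal.ofReal_mul (by positivity)]
    have : 2 * G / π * (π / (2 * G)) = 1 := by
      have := pi_pos
      field_simp
    rw [this, ENNReal.ofReal_one, one_mul]
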